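/- Let $\mathbb K(m)=\int_0^{\pi/2}(1-m\sin^2\theta)^{-1/2}\,d\theta$ be the complete elliptic integral of the first kind (principal branch), and let $$\psi(\omega)=e^{-\pi\,\mathbb K(1-\omega)/\mathbb K(\omega)},\qquad \omega\in\mathbb C\setminus[1,\infty),$$ be the elliptic nome, with $\psi(0)=0$. (At $0$ the singularity is removable. For $\omega<0$ either boundary value of $\mathbb K$ on its cut gives the same value of $\psi$, so $\psi$ is analytic on $\mathbb C\setminus[1,\infty)$.) Let $$\psi_1(\omega)=\frac{1-\sqrt{1-\omega}}{1+\sqrt{1-\omega}}$$ (principal square root) be the conformal map of $\mathbb C\setminus[1,\infty)$ onto the unit disk, and for $k\ge1$ let $\psi_k(\omega)=[\psi_1(\omega^k)]^{1/k}$, with the branch of the $k$-th root that is analytic on $\{\omega:\omega^k\notin[1,\infty)\}$ and has positive derivative at $0$, that is, $\psi_k(\omega)=\omega\,(1+\sqrt{1-\omega^k})^{-2/k}$ with principal powers. Put $\Psi_n=\psi_{2^n}\circ\psi_{2^{n-1}}\circ\cdots\circ\psi_2\circ\psi_1$. Then $\Psi_n\to\psi$ as $n\to\infty$: 1. (First sheet.)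 $\Psi_n\to\psi$ locally uniformly on $\mathbb C\setminus[1,\infty)$. 2. (All sheets of the covering of $\hat{\mathbb C}\setminus\{0,1,\infty\}$ with fixed origin $0$, whose points are the homotopy classes of curves issuing from $0$.) Let $\gamma:[0,1]\to\mathbb C$ be continuous with $\gamma(0)=0$ and $\gamma(t)\notin\{0,1\}$ for $t>0$. Then the germs at $0$ of $\psi$ and of every $\Psi_n$ can be continued analytically along $\gamma$. Moreover, for every $t\in[0,1]$ there is a disk centered at $\gamma(t)$ on which the continuations of $\psi$ and of all $\Psi_n$ up to time $t$ are analytic, and on which those of $\Psi_n$ converge uniformly to that of $\psi$. -/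

import Mathlib

namespace NomeComposition

noncomputable section

/-- Principal branch of the complex square root (cut along the negative real axis). -/
def csqrt (x : ℂ) : ℂ := x ^ (1 / 2 : ℂ)

/-- The one-cut plane `ℂ \ [1, ∞)`. -/
def oneCutPlane : Set ℂ := {ω | ¬ (ω.im = 0 ∧ 1 ≤ ω.re)}

/-- The conformal map `ψ₁` of the one-cut plane onto the unit disk. -/
def psiOne (ω : ℂ) : ℂ := (1 - csqrt (1 - ω)) / (1 + csqrt (1 - ω))

/-- The map `ψ_k(ω) = [ψ₁(ω^k)]^{1/k}`, `k ≥ 1`, with the branch of the `k`-th root that is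
analytic on the plane with the `k` radial cuts `ω^k ∈ [1, ∞)` and has positive derivative at `0`.
Since `ψ₁(u) = u / (1 + √(1 - u))²` and `1 + √(1 - u)` has positive real part, this branch is
`ω · (1 + √(1 - ω^k))^{-2/k}` with principal powers; see `psi_pow`, `psi_differentiableOn` and
`psi_hasDerivAt_zero`. -/
def psi (k : ℕ) (ω : ℂ) : ℂ := ω * (1 + csqrt (1 - ω ^ k)) ^ (-(2 : ℂ) / (k : ℂ))

theorem csqrt_sq (x : ℂ) : csqrt x ^ 2 = x := by
  unfold csqrt
  rw [← Complex.cpow_nat_mul]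
  norm_num

theorem csqrt_re_nonneg (x : ℂ) : 0 ≤ (csqrt x).re := by
  unfold csqrt
  by_cases hx : x = 0
  · subst hx; norm_num
  rw [Complex.cpow_def_of_ne_zero hx, Complex.exp_re]
  have h1 : (Complex.log x * (1 / 2)).im = x.arg / 2 := by
    have : (Complex.log x * (1 / 2 : ℂ)) = Complex.log x / ((2 : ℝ) : ℂ) := by
      push_cast; ring
    rw [this, Complex.div_ofReal_im, Complex.log_im]
  rw [h1]
  refine mul_nonneg (Real.exp_pos _).le (Real.cos_nonneg_of_mem_Icc ⟨?_, ?_⟩)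
  · linarith [Complex.neg_pi_lt_arg x]
  · linarith [Complex.arg_le_pi x]

theorem one_add_csqrt_re_pos (x : ℂ) : 0 < (1 + csqrt x).re := by
  have := csqrt_re_nonneg x
  rw [Complex.add_re, Complex.one_re]; linarith

theorem one_add_csqrt_ne_zero (x : ℂ) : 1 + csqrt x ≠ 0 := fun h => by
  have := one_add_csqrt_re_pos x
  rw [h] at this
  simp at this

theorem psi_pow (k : ℕ) (hk : k ≠ 0) (ω : ℂ) : psi k ω ^ k = psiOne (ω ^ k) := by
  have hne := one_add_csqrt_ne_zero (1 - ω ^ k)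
  have hk' : (k : ℂ) ≠ 0 := by exact_mod_cast hk
  have hsq := csqrt_sq (1 - ω ^ k)
  unfold psi psiOne
  rw [mul_pow, ← Complex.cpow_nat_mul, mul_div_cancel₀ _ hk', Complex.cpow_neg,
    Complex.cpow_ofNat, ← div_eq_mul_inv, div_eq_div_iff (pow_ne_zero 2 hne) hne]
  linear_combination (1 + csqrt (1 - ω ^ k)) * hsq

theorem psi_one (ω : ℂ) : psi 1 ω = psiOne ω := by
  simpa using psi_pow 1 one_ne_zero ω

theorem psi_differentiableOn (k : ℕ) :
    DifferentiableOn ℂ (psi k) {ω | ω ^ k ∈ oneCutPlane} := by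
  intro ω hω
  have hs : 1 - ω ^ k ∈ Complex.slitPlane := by
    rw [Complex.mem_slitPlane_iff]
    by_contra! h
    refine hω ⟨?_, ?_⟩
    · have := h.2; simp at this; simpa using this
    · have := h.1; simp at this; linarith
  refine DifferentiableAt.differentiableWithinAt ?_
  unfold psi csqrt
  have h2 : 1 + (1 - ω ^ k) ^ (1 / 2 : ℂ) ∈ Complex.slitPlane :=
    Or.inl (one_add_csqrt_re_pos (1 - ω ^ k))
  refine differentiableAt_id.mul (DifferentiableAt.cpow_const ?_ h2)
  have h3 : DifferentiableAt ℂ (fun ω : ℂ => 1 - ω ^ k) ω := by fun_prop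
  exact (h3.cpow_const hs).const_add _

theorem psi_hasDerivAt_zero (k : ℕ) (hk : k ≠ 0) :
    HasDerivAt (psi k) (((4 : ℝ) ^ (-1 / (k : ℝ)) : ℝ) : ℂ) 0 := by
  have hg : DifferentiableAt ℂ
      (fun ω : ℂ => (1 + csqrt (1 - ω ^ k)) ^ (-(2 : ℂ) / (k : ℂ))) 0 := by
    unfold csqrt
    refine DifferentiableAt.cpow_const
      ((DifferentiableAt.cpow_const (by fun_prop) ?_).const_add _) ?_
    · simp [hk]
    · exact Or.inl (one_add_csqrt_re_pos (1 - (0 : ℂ) ^ k))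
  have h := (hasDerivAt_id (0 : ℂ)).mul hg.hasDerivAt
  refine h.congr_deriv ?_
  have h1 : csqrt 1 = 1 := by simp [csqrt]
  simp only [id, zero_mul, add_zero, one_mul, zero_pow hk, sub_zero, h1]
  have e : (1 + 1 : ℂ) = ((2 : ℝ) : ℂ) := by norm_num
  have e2 : (-(2 : ℂ) / (k : ℂ)) = ((-2 / (k : ℝ) : ℝ) : ℂ) := by push_cast; ring
  rw [e, e2, ← Complex.ofReal_cpow (by norm_num)]
  congr 1
  rw [show (4 : ℝ) = 2 ^ (2 : ℝ) by norm_num, ← Real.rpow_mul (by norm_num)]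
  congr 1; ring

/-- The composition `ψ_{2^n} ∘ ψ_{2^{n-1}} ∘ ⋯ ∘ ψ₂ ∘ ψ₁`. -/
def psiComp : ℕ → ℂ → ℂ
  | 0 => psiOne
  | n + 1 => psi (2 ^ (n + 1)) ∘ psiComp n

/-- The complete elliptic integral of the first kind, as a function of the parameter `m = k²`,
`K(m) = ∫_0^{π/2} (1 - m sin² θ)^{-1/2} dθ = (π/2) ₂F₁(1/2, 1/2; 1; m)`, principal branch. -/
def ellK (m : ℂ) : ℂ :=
  ∫ θ in (0 : ℝ)..(Real.pi / 2), (1 - m * ((Real.sin θ : ℝ) : ℂ) ^ 2) ^ (-(1 / 2) : ℂ)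

/-- The elliptic nome `q(ω) = exp(-π K(1-ω)/K(ω))` on the first sheet `ℂ \ [1, ∞)`, where `0` is
a removable singularity with value `0`. For `ω < 0` the principal power in `ellK (1 - ω)` selects
one of the two boundary values of `K` on its cut; they differ by `±2i K(ω)`, so `q(ω)` does not
depend on the choice. -/
def nome (ω : ℂ) : ℂ :=
  open Classical in
  if ω = 0 then 0 else Complex.exp (-(Real.pi : ℂ) * ellK (1 - ω) / ellK ω)

/-- `F` is an analytic continuation along the curve `γ` of the germ of `f` at `γ 0`: `F t` is
(a representative of) an analytic germ at `γ t`, and for `s` near `t` the germ at `γ s` is the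
one induced by `F t`. -/
structure IsContinuationAlong (γ : C(unitInterval, ℂ)) (f : ℂ → ℂ)
    (F : unitInterval → ℂ → ℂ) : Prop where
  start : F 0 =ᶠ[nhds (γ 0)] f
  analyticAt : ∀ t, AnalyticAt ℂ (F t) (γ t)
  coherent : ∀ t, ∀ᶠ s in nhds t, F s =ᶠ[nhds (γ s)] F t

/-- A curve that starts at `0` and afterwards avoids `0` and `1`. The homotopy classes of these
curves are the points, other than the origin, of the covering of `Ĉ \ {0, 1, ∞}` with fixed
origin `0`. -/
def IsCurveFromOrigin (γ : C(unitInterval, ℂ)) : Prop :=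
  γ 0 = 0 ∧ ∀ t, t ≠ 0 → γ t ≠ 0 ∧ γ t ≠ 1

end

end NomeComposition

namespace NomeComposition

open Filter Topology MeasureTheory

noncomputable section

/-! ### The factors `ψ_k` and their compositions -/

/-! First sheet. On the closed unit disk `psi k` differs from the identity by O(1/k). With k = 2^n
the increments of the compositions are therefore bounded by a geometric series, and `psiComp`
converges uniformly on the one-cut plane to a holomorphic `psiLim`. Since ψ_{2k}(ω)² = ψ_k(ω²), the
compositions satisfy Ψ_{n+1}(ω)² = Ψ_n(ψ₁(ω)²) (`psiComp_succ_sq`), and the limit inherits Landen's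
equation L(ω)² = L(ψ₁(ω)²). On (0, 1) the nome obeys the same equation: Gauss's transformation
doubles the exponent π K(1-m)/K(m) under m ↦ ψ₁(m)² (`realExponent_landen`). Both this exponent and
-log L(m) are -log m + O(1) as m → 0. Their difference is bounded near 0 and doubles along an orbit
tending to 0, so it vanishes (`exp_neg_realExponent`). The identity theorem extends the equality to
the plane cut along (-∞, 0] and [1, ∞), and a boundary limit extends it to the negative axis.

All sheets. Near the origin every Ψ_n is a function of the nome q alone: if ψ₁ = q exp(e(q)),
Landen's equation gives Ψ_n = q exp(e(q^{2^n})/2^n) (`psiComp_eq_nome_mul_exp`). The same equation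
recovers e at q from its values at q², so e extends to every disk of radius less than 1
(`exists_log_on_disk`). It remains to continue q along the curve with |q| < 1
(`exists_nome_continuation`). The variable w = -log q lives in the right half plane, and the
reflection ω ↦ 1-ω, which leads across [1, ∞), acts on it by w ↦ π²/w up to periods; these maps
preserve the half plane. By compactness |q| stays below some ρ < 1 along the curve, the exponents
e(q^{2^n})/2^n are O(2^{-n}), and the continuations converge to q. -/

theorem isOpen_oneCutPlane : IsOpen oneCutPlane := by
  have : oneCutPlane = {ω : ℂ | ω.im = 0 ∧ 1 ≤ ω.re}ᶜ := rfl
  rw [this, isOpen_compl_iff]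
  exact (isClosed_eq Complex.continuous_im continuous_const).inter
    (isClosed_le continuous_const Complex.continuous_re)

theorem mem_oneCutPlane_of_norm_lt_one {ω : ℂ} (h : ‖ω‖ < 1) : ω ∈ oneCutPlane := by
  rintro ⟨-, h2⟩
  linarith [Complex.re_le_norm ω]

theorem one_sub_mem_slitPlane {ω : ℂ} (h : ω ∈ oneCutPlane) : 1 - ω ∈ Complex.slitPlane := by
  rw [Complex.mem_slitPlane_iff]
  by_contra! h'
  refine h ⟨?_, ?_⟩
  · have := h'.2; simp at this; simpa using this
  · have := h'.1; simp at this; linarith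

theorem norm_csqrt_sq (x : ℂ) : ‖csqrt x‖ ^ 2 = ‖x‖ := by
  rw [← norm_pow, csqrt_sq]

theorem csqrt_re_pos {x : ℂ} (hx : x ∈ Complex.slitPlane) : 0 < (csqrt x).re := by
  refine lt_of_le_of_ne (csqrt_re_nonneg x) fun h => ?_
  have h2 := csqrt_sq x
  have hre : x.re = -((csqrt x).im) ^ 2 := by
    have := congrArg Complex.re h2
    rw [sq, Complex.mul_re, ← h] at this
    linarith
  have him : x.im = 0 := by
    have := congrArg Complex.im h2
    rw [sq, Complex.mul_im, ← h] at this
    linarith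
  rcases hx with h3 | h3
  · nlinarith [sq_nonneg (csqrt x).im]
  · exact h3 him

theorem one_le_norm_one_add_csqrt (x : ℂ) : 1 ≤ ‖1 + csqrt x‖ := by
  refine le_trans ?_ (Complex.re_le_norm _)
  have := csqrt_re_nonneg x
  simp; linarith

theorem norm_one_add_csqrt_le {u : ℂ} (hu : ‖u‖ ≤ 1) : ‖1 + csqrt (1 - u)‖ ≤ 3 := by
  have h1 : ‖1 - u‖ ≤ 2 := (norm_sub_le _ _).trans (by rw [norm_one]; linarith)
  have h2 := norm_csqrt_sq (1 - u)
  have h3 : ‖csqrt (1 - u)‖ ≤ 2 := by nlinarith [norm_nonneg (csqrt (1 - u))]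
  calc _ ≤ ‖(1 : ℂ)‖ + ‖csqrt (1 - u)‖ := norm_add_le _ _
    _ ≤ 3 := by rw [norm_one]; linarith

theorem norm_psi (k : ℕ) (ω : ℂ) :
    ‖psi k ω‖ = ‖ω‖ * ‖1 + csqrt (1 - ω ^ k)‖ ^ (-(2 : ℝ) / k) := by
  have e2 : (-(2 : ℂ) / (k : ℂ)) = ((-(2 : ℝ) / (k : ℝ) : ℝ) : ℂ) := by push_cast; ring
  rw [psi, norm_mul, e2, Complex.norm_cpow_real]

theorem norm_psi_le (k : ℕ) (ω : ℂ) : ‖psi k ω‖ ≤ ‖ω‖ := by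
  rw [norm_psi]
  refine mul_le_of_le_one_right (norm_nonneg _) ?_
  refine Real.rpow_le_one_of_one_le_of_nonpos (one_le_norm_one_add_csqrt _) ?_
  exact div_nonpos_of_nonpos_of_nonneg (by norm_num) (Nat.cast_nonneg k)

theorem le_norm_psi (k : ℕ) {ω : ℂ} (hω : ‖ω‖ ≤ 1) :
    ‖ω‖ * (3 : ℝ) ^ (-(2 : ℝ) / k) ≤ ‖psi k ω‖ := by
  rw [norm_psi]
  refine mul_le_mul_of_nonneg_left ?_ (norm_nonneg _)
  refine Real.rpow_le_rpow_of_nonpos (by linarith [one_le_norm_one_add_csqrt (1 - ω ^ k)])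
    (norm_one_add_csqrt_le ?_) ?_
  · rw [norm_pow]; exact pow_le_one₀ (norm_nonneg _) hω
  · exact div_nonpos_of_nonpos_of_nonneg (by norm_num) (Nat.cast_nonneg k)

/-- The factor multiplying ω is z^{-2/k} with 1 ≤ |z| ≤ 3, whence |log z| ≤ 2 + π ≤ 6. The exponent
has modulus at most 12/k, and |e^y - 1| ≤ 2|y| supplies the last factor 2. -/
theorem norm_psi_sub_le (k : ℕ) {ω : ℂ} (hω : ‖ω‖ ≤ 1) :
    ‖psi k ω - ω‖ ≤ 24 / k := by
  set z : ℂ := 1 + csqrt (1 - ω ^ k) with hz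
  have hz0 : z ≠ 0 := one_add_csqrt_ne_zero _
  have h1 : 1 ≤ ‖z‖ := one_le_norm_one_add_csqrt _
  have h3 : ‖z‖ ≤ 3 := norm_one_add_csqrt_le (by
    rw [norm_pow]; exact pow_le_one₀ (norm_nonneg _) hω)
  have hlog : ‖Complex.log z‖ ≤ 6 := by
    refine (Complex.norm_le_abs_re_add_abs_im _).trans ?_
    rw [Complex.log_re, Complex.log_im, abs_of_nonneg (Real.log_nonneg h1)]
    have := Real.log_le_sub_one_of_pos (by linarith : 0 < ‖z‖)
    have := Complex.abs_arg_le_pi z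
    linarith [Real.pi_lt_four]
  set c : ℂ := z ^ (-(2 : ℂ) / (k : ℂ)) with hc
  have hc1 : ‖c‖ ≤ 1 := by
    have e2 : (-(2 : ℂ) / (k : ℂ)) = ((-(2 : ℝ) / (k : ℝ) : ℝ) : ℂ) := by push_cast; ring
    rw [hc, e2, Complex.norm_cpow_real]
    exact Real.rpow_le_one_of_one_le_of_nonpos h1
      (div_nonpos_of_nonpos_of_nonneg (by norm_num) (Nat.cast_nonneg k))
  have hcexp : c = Complex.exp (Complex.log z * (-(2 : ℂ) / (k : ℂ))) :=
    Complex.cpow_def_of_ne_zero hz0 _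
  have hy : ‖Complex.log z * (-(2 : ℂ) / (k : ℂ))‖ ≤ 12 / k := by
    rw [norm_mul, norm_div, norm_neg, Complex.norm_natCast]
    have : ‖(2 : ℂ)‖ = 2 := by norm_num
    rw [this, mul_div_assoc']
    gcongr; linarith
  -- When the exponent exceeds 1 in modulus, `‖c‖ ≤ 1` alone suffices.
  have hcs : ‖c - 1‖ ≤ 2 * ‖Complex.log z * (-(2 : ℂ) / (k : ℂ))‖ := by
    rcases le_or_gt ‖Complex.log z * (-(2 : ℂ) / (k : ℂ))‖ 1 with h | h
    · rw [hcexp]; exact Complex.norm_exp_sub_one_le h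
    · refine (norm_sub_le _ _).trans ?_
      rw [norm_one]; linarith
  have : psi k ω - ω = ω * (c - 1) := by rw [psi, hc, hz]; ring
  rw [this, norm_mul]
  calc ‖ω‖ * ‖c - 1‖ ≤ 1 * (2 * (12 / k)) := by
        refine mul_le_mul hω (hcs.trans (by linarith)) (norm_nonneg _) zero_le_one
    _ = 24 / k := by ring

/-- The square root has positive real part off the cut, and the Cayley transform s ↦ (1-s)/(1+s)
sends the right half plane into the disk. -/
theorem norm_psiOne_lt_one {ω : ℂ} (h : ω ∈ oneCutPlane) : ‖psiOne ω‖ < 1 := by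
  have hs := csqrt_re_pos (one_sub_mem_slitPlane h)
  set s := csqrt (1 - ω) with hsdef
  have h0 : 0 < ‖1 + s‖ := by linarith [one_le_norm_one_add_csqrt (1 - ω)]
  rw [psiOne, ← hsdef, norm_div, div_lt_one h0]
  refine lt_of_pow_lt_pow_left₀ 2 h0.le ?_
  rw [← Complex.normSq_eq_norm_sq, ← Complex.normSq_eq_norm_sq, Complex.normSq_apply,
    Complex.normSq_apply]
  simp; nlinarith

theorem norm_psiOne_le (ω : ℂ) : ‖psiOne ω‖ ≤ ‖ω‖ := by
  rw [← psi_one]; exact norm_psi_le 1 ω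

theorem le_norm_psiOne {ω : ℂ} (hω : ‖ω‖ ≤ 1) : ‖ω‖ / 9 ≤ ‖psiOne ω‖ := by
  rw [← psi_one]
  refine le_trans (le_of_eq ?_) (le_norm_psi 1 hω)
  rw [Nat.cast_one, div_one, Real.rpow_neg (by norm_num)]
  norm_num [div_eq_mul_inv]

theorem psiOne_ne_zero {ω : ℂ} (h : ω ≠ 0) : psiOne ω ≠ 0 := by
  rw [← psi_one, psi]
  refine mul_ne_zero h ?_
  rw [Complex.cpow_def_of_ne_zero (one_add_csqrt_ne_zero _)]
  exact Complex.exp_ne_zero _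

theorem psiOne_differentiableOn : DifferentiableOn ℂ psiOne oneCutPlane := by
  have := psi_differentiableOn 1
  simp only [pow_one] at this
  exact this.congr fun ω _ => (psi_one ω).symm

theorem norm_psiComp_lt_one (n : ℕ) {ω : ℂ} (h : ω ∈ oneCutPlane) : ‖psiComp n ω‖ < 1 := by
  induction n with
  | zero => exact norm_psiOne_lt_one h
  | succ n ih => exact (norm_psi_le _ _).trans_lt ih

theorem norm_psiComp_le (n : ℕ) (ω : ℂ) : ‖psiComp n ω‖ ≤ ‖psiOne ω‖ := by
  induction n with
  | zero => exact le_rfl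
  | succ n ih => exact (norm_psi_le _ _).trans ih

/-- The lower bounds 3^{-2/2^j} of the factors multiply, and 2/2 + 2/4 + ⋯ + 2/2^n = 2(1 - 2^{-n}).
The constant never falls below 1/9, so the limit has no zero except the origin. -/
theorem le_norm_psiComp (n : ℕ) {ω : ℂ} (h : ω ∈ oneCutPlane) :
    ‖psiOne ω‖ * (3 : ℝ) ^ (-(2 : ℝ) * (1 - 1 / 2 ^ n)) ≤ ‖psiComp n ω‖ := by
  induction n with
  | zero => simp [psiComp]
  | succ n ih =>
    refine le_trans (le_of_eq ?_) ((mul_le_mul_of_nonneg_right ih (by positivity)).trans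
      (le_norm_psi (2 ^ (n + 1)) (norm_psiComp_lt_one n h).le))
    rw [mul_assoc, ← Real.rpow_add (by norm_num)]
    congr 2
    push_cast
    field_simp
    ring

theorem psiComp_differentiableOn (n : ℕ) : DifferentiableOn ℂ (psiComp n) oneCutPlane := by
  induction n with
  | zero => exact psiOne_differentiableOn
  | succ n ih =>
    refine (psi_differentiableOn _).comp ih fun ω h => ?_
    refine mem_oneCutPlane_of_norm_lt_one ?_
    rw [norm_pow]
    exact pow_lt_one₀ (norm_nonneg _) (norm_psiComp_lt_one n h) (by positivity)

theorem psi_two_mul_sq (k : ℕ) (hk : k ≠ 0) (ω : ℂ) : psi (2 * k) ω ^ 2 = psi k (ω ^ 2) := by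
  unfold psi
  have hk' : (k : ℂ) ≠ 0 := by exact_mod_cast hk
  rw [mul_pow, ← Complex.cpow_nat_mul, ← pow_mul]
  congr 2
  push_cast
  field_simp

/-- Squaring passes through each factor and halves its index, so it shifts the whole composition
down by one place. This is the equation that the limit will share with the nome. -/
theorem psiComp_succ_sq (n : ℕ) (ω : ℂ) : psiComp (n + 1) ω ^ 2 = psiComp n (psiOne ω ^ 2) := by
  induction n with
  | zero =>
    have := psi_two_mul_sq 1 one_ne_zero (psiOne ω)
    rw [psi_one] at this
    simpa [psiComp] using this
  | succ n ih =>
    have := psi_two_mul_sq (2 ^ (n + 1)) (by positivity) (psiComp (n + 1) ω)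
    rw [ih, ← pow_succ'] at this
    simpa [psiComp] using this

/-! ### The limit of the compositions and its functional equation -/

/-- The limit of the compositions `Ψ_n`, written as a telescoping series. -/
def psiLim (ω : ℂ) : ℂ := psiOne ω + ∑' n, (psiComp (n + 1) ω - psiComp n ω)

theorem tendstoUniformlyOn_psiComp :
    TendstoUniformlyOn psiComp psiLim atTop oneCutPlane := by
  have hs : Summable fun n : ℕ => (24 : ℝ) / ((2 ^ (n + 1) : ℕ) : ℝ) := by
    have := (summable_geometric_two).mul_left (12 : ℝ)
    refine this.congr fun n => ?_
    push_cast
    rw [pow_succ, one_div, inv_pow]; field_simp; norm_num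
  have h := tendstoUniformlyOn_tsum_nat (f := fun n ω => psiComp (n + 1) ω - psiComp n ω) hs
    (s := oneCutPlane) fun n ω hω => norm_psi_sub_le (2 ^ (n + 1)) (norm_psiComp_lt_one n hω).le
  rw [Metric.tendstoUniformlyOn_iff] at h ⊢
  intro ε hε
  filter_upwards [h ε hε] with n hn ω hω
  have := hn ω hω
  rw [Finset.sum_range_sub (fun n => psiComp n ω)] at this
  rw [dist_eq_norm] at this ⊢
  convert this using 2
  simp only [psiLim, psiComp]; ring

theorem tendsto_psiComp {ω : ℂ} (h : ω ∈ oneCutPlane) :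
    Tendsto (fun n => psiComp n ω) atTop (𝓝 (psiLim ω)) :=
  tendstoUniformlyOn_psiComp.tendsto_at h

theorem psiLim_differentiableOn : DifferentiableOn ℂ psiLim oneCutPlane :=
  tendstoUniformlyOn_psiComp.tendstoLocallyUniformlyOn.differentiableOn
    (Eventually.of_forall psiComp_differentiableOn) isOpen_oneCutPlane

theorem norm_psiLim_le {ω : ℂ} (h : ω ∈ oneCutPlane) : ‖psiLim ω‖ ≤ ‖psiOne ω‖ :=
  le_of_tendsto (tendsto_psiComp h).norm (Eventually.of_forall fun n => norm_psiComp_le n ω)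

theorem norm_psiLim_lt_one {ω : ℂ} (h : ω ∈ oneCutPlane) : ‖psiLim ω‖ < 1 :=
  (norm_psiLim_le h).trans_lt (norm_psiOne_lt_one h)

theorem le_norm_psiLim {ω : ℂ} (h : ω ∈ oneCutPlane) : ‖psiOne ω‖ / 9 ≤ ‖psiLim ω‖ := by
  refine ge_of_tendsto (tendsto_psiComp h).norm (Eventually.of_forall fun n => ?_)
  refine le_trans ?_ (le_norm_psiComp n h)
  rw [div_eq_mul_inv]
  refine mul_le_mul_of_nonneg_left ?_ (norm_nonneg _)
  have : (9 : ℝ)⁻¹ = (3 : ℝ) ^ (-(2 : ℝ)) := by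
    rw [Real.rpow_neg (by norm_num)]; norm_num
  rw [this]
  refine Real.rpow_le_rpow_of_exponent_le (by norm_num) ?_
  have : (0 : ℝ) ≤ 1 / 2 ^ n := by positivity
  linarith

theorem psiLim_zero : psiLim 0 = 0 := by
  have h0 : (0 : ℂ) ∈ oneCutPlane := mem_oneCutPlane_of_norm_lt_one (by simp)
  have h := (norm_psiLim_le h0).trans (norm_psiOne_le 0)
  simpa using h

theorem psiLim_ne_zero {ω : ℂ} (h : ω ∈ oneCutPlane) (h0 : ω ≠ 0) : psiLim ω ≠ 0 := by
  have h1 := le_norm_psiLim h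
  have h2 := norm_pos_iff.2 (psiOne_ne_zero h0)
  exact norm_pos_iff.1 (by linarith)

theorem psiOne_sq_mem {ω : ℂ} (h : ω ∈ oneCutPlane) : psiOne ω ^ 2 ∈ oneCutPlane := by
  refine mem_oneCutPlane_of_norm_lt_one ?_
  rw [norm_pow]
  exact pow_lt_one₀ (norm_nonneg _) (norm_psiOne_lt_one h) two_ne_zero

theorem psiLim_sq {ω : ℂ} (h : ω ∈ oneCutPlane) : psiLim ω ^ 2 = psiLim (psiOne ω ^ 2) := by
  have h1 := ((tendsto_psiComp h).comp (tendsto_add_atTop_nat 1)).pow 2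
  refine tendsto_nhds_unique h1 ((tendsto_psiComp (psiOne_sq_mem h)).congr fun n => ?_)
  exact (psiComp_succ_sq n ω).symm

/-! ### Gauss's transformation of the real elliptic integral -/

/-- The integral `∫_0^{π/2} dθ / √(a² cos² θ + b² sin² θ)`. -/
def gaussIntegral (a b : ℝ) : ℝ :=
  ∫ θ in (0 : ℝ)..(Real.pi / 2), (√(a ^ 2 * Real.cos θ ^ 2 + b ^ 2 * Real.sin θ ^ 2))⁻¹

theorem image_mul_tan {b : ℝ} (hb : 0 < b) :
    (fun θ => b * Real.tan θ) '' Set.Ioo 0 (Real.pi / 2) = Set.Ioi 0 := by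
  ext x
  simp only [Set.mem_image, Set.mem_Ioo, Set.mem_Ioi]
  constructor
  · rintro ⟨θ, hθ, rfl⟩
    exact mul_pos hb (Real.tan_pos_of_pos_of_lt_pi_div_two hθ.1 hθ.2)
  · intro hx
    refine ⟨Real.arctan (x / b), ⟨Real.arctan_pos.2 (by positivity),
      Real.arctan_lt_pi_div_two _⟩, ?_⟩
    rw [Real.tan_arctan]; field_simp

/-- Substitution x = b tan θ; in this algebraic form Gauss's transformation is a rational change of
variable. -/
theorem gaussIntegral_eq_integral_Ioi {a b : ℝ} (ha : 0 < a) (hb : 0 < b) :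
    gaussIntegral a b = ∫ x in Set.Ioi (0 : ℝ), (√((a ^ 2 + x ^ 2) * (b ^ 2 + x ^ 2)))⁻¹ := by
  rw [gaussIntegral, intervalIntegral.integral_of_le (by positivity),
    integral_Ioc_eq_integral_Ioo, ← image_mul_tan hb,
    integral_image_eq_integral_abs_deriv_smul (f' := fun θ => b * (1 / Real.cos θ ^ 2))
      measurableSet_Ioo]
  · refine setIntegral_congr_fun measurableSet_Ioo fun θ hθ => ?_
    have hc : 0 < Real.cos θ := Real.cos_pos_of_mem_Ioo ⟨by linarith [hθ.1, Real.pi_pos], hθ.2⟩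
    have hs : Real.sin θ ^ 2 = 1 - Real.cos θ ^ 2 := by linarith [Real.sin_sq_add_cos_sq θ]
    have e : (a ^ 2 + (b * Real.tan θ) ^ 2) * (b ^ 2 + (b * Real.tan θ) ^ 2) =
        (b / Real.cos θ ^ 2) ^ 2 * (a ^ 2 * Real.cos θ ^ 2 + b ^ 2 * Real.sin θ ^ 2) := by
      rw [Real.tan_eq_sin_div_cos]
      have : (b ^ 2 + (b * (Real.sin θ / Real.cos θ)) ^ 2) = b ^ 2 / Real.cos θ ^ 2 := by
        field_simp
        linarith [Real.sin_sq_add_cos_sq θ]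
      rw [this]
      field_simp
    have hp : 0 < b / Real.cos θ ^ 2 := by positivity
    simp only [e, smul_eq_mul]
    rw [Real.sqrt_mul (by positivity), Real.sqrt_sq hp.le, mul_one_div, abs_of_pos hp, mul_inv,
      ← mul_assoc, mul_inv_cancel₀ hp.ne', one_mul]
  · intro θ hθ
    have hc : 0 < Real.cos θ := Real.cos_pos_of_mem_Ioo ⟨by linarith [hθ.1, Real.pi_pos], hθ.2⟩
    exact ((Real.hasDerivAt_tan hc.ne').const_mul b).hasDerivWithinAt
  · intro x hx y hy h
    refine Real.injOn_tan ⟨by linarith [hx.1, Real.pi_pos], hx.2⟩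
      ⟨by linarith [hy.1, Real.pi_pos], hy.2⟩ (mul_left_cancel₀ hb.ne' h)

theorem image_half_sub_div {c : ℝ} (hc : 0 < c) :
    (fun x : ℝ => (x - c / x) / 2) '' Set.Ioi 0 = Set.univ := by
  refine Set.eq_univ_of_forall fun y => ?_
  have h1 : 0 ≤ y ^ 2 + c := by positivity
  have h2 : |y| < √(y ^ 2 + c) := by
    rw [← Real.sqrt_sq_eq_abs]; exact Real.sqrt_lt_sqrt (sq_nonneg y) (by linarith)
  have h3 : 0 < y + √(y ^ 2 + c) := by linarith [neg_abs_le y]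
  -- The positive root of x² - 2yx - c = 0.
  refine ⟨y + √(y ^ 2 + c), h3, ?_⟩
  have h4 := Real.sq_sqrt h1
  have h5 := h3.ne'
  field_simp
  linear_combination h4

/-- The substitution y = (x - ab/x)/2 maps the positive half line bijectively onto the whole line
and carries the integrand of the two means to twice that of a and b. Evenness of the former
compensates the factor 2. -/
theorem gaussIntegral_agm {a b : ℝ} (ha : 0 < a) (hb : 0 < b) :
    gaussIntegral ((a + b) / 2) (√(a * b)) = gaussIntegral a b := by
  have hab : 0 < a * b := mul_pos ha hb
  rw [gaussIntegral_eq_integral_Ioi (by positivity) (by positivity),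
    gaussIntegral_eq_integral_Ioi ha hb]
  set f : ℝ → ℝ := fun x => (√((((a + b) / 2) ^ 2 + x ^ 2) * (√(a * b) ^ 2 + x ^ 2)))⁻¹ with hf
  have heven : ∫ x, f x = 2 * ∫ x in Set.Ioi (0 : ℝ), f x := by
    rw [← integral_comp_abs]
    simp only [hf, sq_abs]
  have hsub : ∫ x, f x =
      ∫ x in Set.Ioi (0 : ℝ), 2 * (√((a ^ 2 + x ^ 2) * (b ^ 2 + x ^ 2)))⁻¹ := by
    rw [← setIntegral_univ, ← image_half_sub_div hab,
      integral_image_eq_integral_abs_deriv_smul (f' := fun x => (1 + a * b / x ^ 2) / 2)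
        measurableSet_Ioi]
    · refine setIntegral_congr_fun measurableSet_Ioi fun x hx => ?_
      have hx : 0 < x := hx
      have e : (((a + b) / 2) ^ 2 + ((x - a * b / x) / 2) ^ 2) *
          (√(a * b) ^ 2 + ((x - a * b / x) / 2) ^ 2) =
          ((1 + a * b / x ^ 2) / 4) ^ 2 * ((a ^ 2 + x ^ 2) * (b ^ 2 + x ^ 2)) := by
        rw [Real.sq_sqrt hab.le]
        field_simp
        ring
      have hp : 0 < (1 + a * b / x ^ 2) / 4 := by positivity
      have hp2 : 0 < (1 + a * b / x ^ 2) / 2 := by positivity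
      simp only [hf, e, smul_eq_mul]
      rw [Real.sqrt_mul (by positivity), Real.sqrt_sq hp.le, abs_of_pos hp2, mul_inv, ← mul_assoc]
      congr 1
      field_simp
      norm_num
    · intro x hx
      have hx : 0 < x := hx
      have h := (((hasDerivAt_id x).sub ((hasDerivAt_inv hx.ne').const_mul (a * b))).div_const 2)
      refine (h.congr_deriv ?_).hasDerivWithinAt
      field_simp
      ring
    · intro x hx y hy h
      have hx : 0 < x := hx
      have hy : 0 < y := hy
      have h' : (x - a * b / x) / 2 = (y - a * b / y) / 2 := h
      have h2 : (x - y) * (x * y + a * b) = 0 := by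
        field_simp at h'
        linear_combination h'
      rcases mul_eq_zero.1 h2 with h3 | h3
      · linarith
      · have := mul_pos hx hy; linarith
  rw [hsub, integral_const_mul] at heven
  linarith

theorem gaussIntegral_const_mul {c : ℝ} (hc : 0 < c) (a b : ℝ) :
    gaussIntegral (c * a) (c * b) = c⁻¹ * gaussIntegral a b := by
  rw [gaussIntegral, gaussIntegral, ← intervalIntegral.integral_const_mul]
  congr 1
  ext θ
  have : (c * a) ^ 2 * Real.cos θ ^ 2 + (c * b) ^ 2 * Real.sin θ ^ 2 =
    c ^ 2 * (a ^ 2 * Real.cos θ ^ 2 + b ^ 2 * Real.sin θ ^ 2) := by ring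
  rw [this, Real.sqrt_mul (by positivity), Real.sqrt_sq hc.le, mul_inv]

theorem gaussIntegrand_radicand_pos {a b : ℝ} (ha : 0 < a) (hb : 0 < b) (θ : ℝ) :
    0 < a ^ 2 * Real.cos θ ^ 2 + b ^ 2 * Real.sin θ ^ 2 := by
  have h := Real.sin_sq_add_cos_sq θ
  rcases eq_or_ne (Real.sin θ) 0 with h0 | h0
  · have : Real.cos θ ^ 2 = 1 := by rw [h0] at h; linarith
    rw [h0, this]; positivity
  · positivity

theorem gaussIntegrand_continuous {a b : ℝ} (ha : 0 < a) (hb : 0 < b) :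
    Continuous fun θ => (√(a ^ 2 * Real.cos θ ^ 2 + b ^ 2 * Real.sin θ ^ 2))⁻¹ := by
  refine Continuous.inv₀ (by fun_prop) fun θ => ?_
  exact (Real.sqrt_pos.2 (gaussIntegrand_radicand_pos ha hb θ)).ne'

theorem ellK_ofReal {m : ℝ} (hm : m < 1) : ellK m = (gaussIntegral 1 (√(1 - m)) : ℝ) := by
  rw [ellK, gaussIntegral, ← intervalIntegral.integral_ofReal]
  congr 1
  ext θ
  have h1 : (1 : ℝ) ^ 2 * Real.cos θ ^ 2 + √(1 - m) ^ 2 * Real.sin θ ^ 2 =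
      1 - m * Real.sin θ ^ 2 := by
    rw [Real.sq_sqrt (by linarith)]; linarith [Real.sin_sq_add_cos_sq θ]
  have hpos := gaussIntegrand_radicand_pos one_pos (Real.sqrt_pos.2 (by linarith : 0 < 1 - m)) θ
  rw [h1] at hpos ⊢
  have e : (1 - (m : ℂ) * ((Real.sin θ : ℝ) : ℂ) ^ 2) = ((1 - m * Real.sin θ ^ 2 : ℝ) : ℂ) := by
    push_cast; ring
  have e2 : (-(1 / 2) : ℂ) = ((-(1 / 2) : ℝ) : ℂ) := by push_cast; ring
  rw [e, e2, ← Complex.ofReal_cpow hpos.le, Real.rpow_neg hpos.le, ← Real.sqrt_eq_rpow]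

/-! ### The nome on the interval `(0, 1)` -/

theorem gaussIntegral_comm (a b : ℝ) : gaussIntegral a b = gaussIntegral b a := by
  have := intervalIntegral.integral_comp_sub_left (a := 0) (b := Real.pi / 2)
    (fun θ => (√(b ^ 2 * Real.cos θ ^ 2 + a ^ 2 * Real.sin θ ^ 2))⁻¹) (Real.pi / 2)
  simp only [Real.cos_pi_div_two_sub, Real.sin_pi_div_two_sub, sub_self, sub_zero] at this
  rw [gaussIntegral, gaussIntegral, ← this]
  congr 1
  ext θ
  rw [add_comm]

theorem gaussIntegral_pos {a b : ℝ} (ha : 0 < a) (hb : 0 < b) : 0 < gaussIntegral a b :=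
  intervalIntegral.intervalIntegral_pos_of_pos
    ((gaussIntegrand_continuous ha hb).intervalIntegrable _ _)
    (fun θ => inv_pos.2 (Real.sqrt_pos.2 (gaussIntegrand_radicand_pos ha hb θ)))
    (by positivity)

/-! ### Logarithmic growth of the elliptic integral -/

theorem hasDerivAt_arsinh_div {k : ℝ} (hk : 0 < k) (x : ℝ) :
    HasDerivAt (fun x => Real.arsinh (x / k)) (√(k ^ 2 + x ^ 2))⁻¹ x := by
  have h := ((hasDerivAt_id x).div_const k).arsinh
  refine h.congr_deriv ?_
  have e : k ^ 2 + x ^ 2 = k ^ 2 * (1 + (x / k) ^ 2) := by field_simp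
  rw [e, Real.sqrt_mul (by positivity), Real.sqrt_sq hk.le, mul_inv]
  simp [mul_comm]

/-- As sin θ ≤ θ, the radicand is at most k² + θ², and the resulting integral is arsinh(π/(2k)) ≥
log(1/k). -/
theorem neg_log_le_gaussIntegral {k : ℝ} (hk : 0 < k) : -Real.log k ≤ gaussIntegral k 1 := by
  have hcont : Continuous fun x : ℝ => (√(k ^ 2 + x ^ 2))⁻¹ :=
    Continuous.inv₀ (by fun_prop) fun x => (Real.sqrt_pos.2 (by positivity)).ne'
  have harsinh : ∫ x in (0 : ℝ)..(Real.pi / 2), (√(k ^ 2 + x ^ 2))⁻¹ =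
      Real.arsinh (Real.pi / 2 / k) := by
    rw [intervalIntegral.integral_eq_sub_of_hasDerivAt (fun x _ => hasDerivAt_arsinh_div hk x)
      (hcont.intervalIntegrable _ _)]
    simp
  have h1 : -Real.log k ≤ Real.arsinh (Real.pi / 2 / k) := by
    rw [← Real.log_inv, Real.arsinh]
    refine Real.log_le_log (by positivity) ?_
    have h3 : k⁻¹ ≤ Real.pi / 2 / k := by
      rw [inv_eq_one_div]; gcongr; linarith [Real.pi_gt_three]
    linarith [Real.sqrt_nonneg (1 + (Real.pi / 2 / k) ^ 2)]
  rw [← harsinh] at h1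
  refine h1.trans (intervalIntegral.integral_mono_on (by positivity)
    (hcont.intervalIntegrable _ _)
    ((gaussIntegrand_continuous hk one_pos).intervalIntegrable _ _) fun x hx => ?_)
  refine inv_anti₀ (Real.sqrt_pos.2 (gaussIntegrand_radicand_pos hk one_pos x))
    (Real.sqrt_le_sqrt ?_)
  have h3 := Real.sin_le hx.1
  have h4 : 0 ≤ Real.sin x := Real.sin_nonneg_of_nonneg_of_le_pi hx.1
    (by linarith [hx.2, Real.pi_pos])
  have h5 : Real.sin x ^ 2 ≤ x ^ 2 := by gcongr
  have h6 : k ^ 2 * Real.cos x ^ 2 ≤ k ^ 2 :=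
    mul_le_of_le_one_right (by positivity) (Real.cos_sq_le_one x)
  linarith

/-- On [0, π/4] the weight 1/cos θ ≥ 1 makes the integrand the derivative of arsinh(tan θ / k),
which contributes at most -log k + 2. On [π/4, π/2] the integrand is at most 2 because sin θ ≥ 1/2,
which contributes at most 2. -/
theorem gaussIntegral_le_neg_log {k : ℝ} (hk : 0 < k) (hk1 : k ≤ 1) :
    gaussIntegral k 1 ≤ -Real.log k + 4 := by
  set g : ℝ → ℝ := fun θ => (√(k ^ 2 * Real.cos θ ^ 2 + 1 ^ 2 * Real.sin θ ^ 2))⁻¹ with hg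
  have hgc : Continuous g := gaussIntegrand_continuous hk one_pos
  have hsplit : gaussIntegral k 1 = (∫ θ in (0 : ℝ)..(Real.pi / 4), g θ) +
      ∫ θ in (Real.pi / 4)..(Real.pi / 2), g θ :=
    (intervalIntegral.integral_add_adjacent_intervals (hgc.intervalIntegrable _ _)
      (hgc.intervalIntegrable _ _)).symm
  have hcos : ∀ θ ∈ Set.Icc 0 (Real.pi / 4), 0 < Real.cos θ := fun θ hθ =>
    Real.cos_pos_of_mem_Ioo ⟨by linarith [hθ.1, Real.pi_pos], by linarith [hθ.2, Real.pi_pos]⟩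
  have hderiv : ∀ θ ∈ Set.Icc 0 (Real.pi / 4),
      HasDerivAt (fun θ => Real.arsinh (Real.tan θ / k)) ((Real.cos θ)⁻¹ * g θ) θ := by
    intro θ hθ
    have hc := hcos θ hθ
    refine ((hasDerivAt_arsinh_div hk (Real.tan θ)).comp θ
      (Real.hasDerivAt_tan hc.ne')).congr_deriv ?_
    have e : k ^ 2 * Real.cos θ ^ 2 + 1 ^ 2 * Real.sin θ ^ 2 =
        Real.cos θ ^ 2 * (k ^ 2 + Real.tan θ ^ 2) := by
      rw [Real.tan_eq_sin_div_cos]; field_simp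
    simp only [hg]
    rw [e, Real.sqrt_mul (by positivity), Real.sqrt_sq hc.le, mul_inv]
    field_simp
  have hcont : ContinuousOn (fun θ => (Real.cos θ)⁻¹ * g θ) (Set.Icc 0 (Real.pi / 4)) :=
    (Real.continuous_cos.continuousOn.inv₀ fun θ hθ => (hcos θ hθ).ne').mul hgc.continuousOn
  have hle : (0 : ℝ) ≤ Real.pi / 4 := by positivity
  have hii : IntervalIntegrable (fun θ => (Real.cos θ)⁻¹ * g θ) volume 0 (Real.pi / 4) :=
    ContinuousOn.intervalIntegrable (by rwa [Set.uIcc_of_le hle])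
  have h1 : ∫ θ in (0 : ℝ)..(Real.pi / 4), g θ ≤ Real.arsinh (1 / k) := by
    have : ∫ θ in (0 : ℝ)..(Real.pi / 4), (Real.cos θ)⁻¹ * g θ = Real.arsinh (1 / k) := by
      rw [intervalIntegral.integral_eq_sub_of_hasDerivAt
        (fun x hx => hderiv x (by rwa [Set.uIcc_of_le hle] at hx)) hii]
      simp
    rw [← this]
    refine intervalIntegral.integral_mono_on hle (hgc.intervalIntegrable _ _) hii fun x hx => ?_
    refine le_mul_of_one_le_left (inv_nonneg.2 (Real.sqrt_nonneg _)) ?_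
    exact (one_le_inv₀ (hcos x hx)).2 (Real.cos_le_one x)
  have h2 : ∫ θ in (Real.pi / 4)..(Real.pi / 2), g θ ≤ 2 := by
    have hle2 : Real.pi / 4 ≤ Real.pi / 2 := by linarith [Real.pi_pos]
    have : ∫ θ in (Real.pi / 4)..(Real.pi / 2), g θ ≤
        ∫ θ in (Real.pi / 4)..(Real.pi / 2), (2 : ℝ) := by
      refine intervalIntegral.integral_mono_on hle2 (hgc.intervalIntegrable _ _)
        (by simp) fun x hx => ?_
      have h4 : Real.sin (Real.pi / 4) ≤ Real.sin x :=
        Real.sin_le_sin_of_le_of_le_pi_div_two (by linarith [Real.pi_pos]) hx.2 hx.1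
      rw [Real.sin_pi_div_four] at h4
      have h5 : (1 / 2 : ℝ) ≤ Real.sin x := by
        have : (1 : ℝ) ≤ √2 := by rw [Real.one_le_sqrt]; norm_num
        linarith
      have h6 : (1 / 2 : ℝ) ≤ √(k ^ 2 * Real.cos x ^ 2 + 1 ^ 2 * Real.sin x ^ 2) := by
        refine Real.le_sqrt_of_sq_le ?_
        have : (1 / 2 : ℝ) ^ 2 ≤ Real.sin x ^ 2 := by gcongr
        have : 0 ≤ k ^ 2 * Real.cos x ^ 2 := by positivity
        linarith
      calc g x ≤ (1 / 2 : ℝ)⁻¹ := inv_anti₀ (by norm_num) h6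
        _ = 2 := by norm_num
    rw [intervalIntegral.integral_const] at this
    refine this.trans ?_
    rw [smul_eq_mul]
    linarith [Real.pi_lt_four]
  have h3 : Real.arsinh (1 / k) ≤ -Real.log k + 2 := by
    have h4 : 1 ≤ 1 / k := by rw [le_div_iff₀ hk]; linarith
    have h5 : √(1 + (1 / k) ^ 2) ≤ 2 / k := by
      refine Real.sqrt_le_iff.2 ⟨by positivity, ?_⟩
      have : (2 / k) ^ 2 = 4 * (1 / k) ^ 2 := by ring
      nlinarith
    rw [Real.arsinh]
    calc Real.log (1 / k + √(1 + (1 / k) ^ 2)) ≤ Real.log (3 * k⁻¹) := by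
          refine Real.log_le_log (by positivity) ?_
          have : 3 * k⁻¹ = 1 / k + 2 / k := by ring
          linarith
      _ = Real.log 3 - Real.log k := by
          rw [Real.log_mul (by norm_num) (by positivity), Real.log_inv]; ring
      _ ≤ _ := by
          have := Real.log_le_sub_one_of_pos (by norm_num : (0 : ℝ) < 3)
          linarith
  linarith

theorem le_gaussIntegral_one {b : ℝ} (hb : 0 < b) (hb1 : b ≤ 1) :
    Real.pi / 2 ≤ gaussIntegral 1 b := by
  have h : ∫ _ in (0 : ℝ)..(Real.pi / 2), (1 : ℝ) = Real.pi / 2 := by simp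
  rw [← h]
  refine intervalIntegral.integral_mono_on (by positivity) (by simp)
    ((gaussIntegrand_continuous one_pos hb).intervalIntegrable _ _) fun x _ => ?_
  refine (one_le_inv₀ (Real.sqrt_pos.2 (gaussIntegrand_radicand_pos one_pos hb x))).2 ?_
  refine Real.sqrt_le_one.2 ?_
  have h1 : b ^ 2 * Real.sin x ^ 2 ≤ 1 * Real.sin x ^ 2 := by
    gcongr; nlinarith
  linarith [Real.sin_sq_add_cos_sq x]

theorem gaussIntegral_one_le {b : ℝ} (hb : 0 < b) (hb1 : b ≤ 1) :
    gaussIntegral 1 b ≤ Real.pi / 2 * b⁻¹ := by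
  have h : ∫ _ in (0 : ℝ)..(Real.pi / 2), (b⁻¹ : ℝ) = Real.pi / 2 * b⁻¹ := by simp
  rw [← h]
  refine intervalIntegral.integral_mono_on (by positivity)
    ((gaussIntegrand_continuous one_pos hb).intervalIntegrable _ _) (by simp) fun x _ => ?_
  refine inv_anti₀ hb (Real.le_sqrt_of_sq_le ?_)
  have h1 : b ^ 2 * Real.cos x ^ 2 ≤ 1 * Real.cos x ^ 2 := by
    gcongr; nlinarith
  nlinarith [Real.sin_sq_add_cos_sq x]

/-! ### Landen's transformation of the exponent -/

/-- The exponent `π K(1-m) / K(m)` for a real parameter. -/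
def realExponent (m : ℝ) : ℝ :=
  Real.pi * gaussIntegral 1 √m / gaussIntegral 1 √(1 - m)

/-- The descending Landen transformation of the parameter. -/
def landen (m : ℝ) : ℝ := ((1 - √(1 - m)) / (1 + √(1 - m))) ^ 2

theorem landen_pos {m : ℝ} (h0 : 0 < m) : 0 < landen m := by
  have : √(1 - m) < 1 := by
    rw [Real.sqrt_lt' one_pos]; linarith
  have h2 : 0 < 1 - √(1 - m) := by linarith
  have := Real.sqrt_nonneg (1 - m)
  unfold landen; positivity

theorem landen_le_sq {m : ℝ} (h0 : 0 < m) (h1 : m < 1) : landen m ≤ m ^ 2 := by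
  have h2 := Real.sq_sqrt (by linarith : 0 ≤ 1 - m)
  have h3 := Real.sqrt_nonneg (1 - m)
  have h4 : √(1 - m) < 1 := by
    rw [Real.sqrt_lt' one_pos]; linarith
  have : (1 - √(1 - m)) / (1 + √(1 - m)) ≤ m := by
    rw [div_le_iff₀ (by linarith)]; nlinarith
  unfold landen
  have h5 : 0 ≤ (1 - √(1 - m)) / (1 + √(1 - m)) := div_nonneg (by linarith) (by linarith)
  gcongr

/-- With k = √(1-m), one step of the arithmetic-geometric mean takes (1+k, 1-k) to (1, √m), and (1,
k) to ((1+k)/2, √k). After rescaling, the numerator of the exponent gains 1+k and the denominator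
(1+k)/2, so the quotient doubles. -/
theorem realExponent_landen {m : ℝ} (h0 : 0 < m) (h1 : m < 1) :
    realExponent (landen m) = 2 * realExponent m := by
  set k := √(1 - m) with hk
  have hk0 : 0 < k := Real.sqrt_pos.2 (by linarith)
  have hk1 : k < 1 := by rw [hk, Real.sqrt_lt' one_pos]; linarith
  have hk2 : k ^ 2 = 1 - m := Real.sq_sqrt (by linarith)
  have hk3 : 0 < 1 - k := by linarith
  have hk4 : 0 < 1 + k := by linarith
  have hl : landen m = ((1 - k) / (1 + k)) ^ 2 := rfl
  have e1 : gaussIntegral 1 √(landen m) = (1 + k) * gaussIntegral 1 √m := by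
    have h := gaussIntegral_agm hk4 hk3
    have h' := gaussIntegral_const_mul (inv_pos.2 hk4) (1 + k) (1 - k)
    rw [inv_mul_cancel₀ hk4.ne', inv_inv] at h'
    rw [hl, Real.sqrt_sq (by positivity), div_eq_inv_mul, h', ← h]
    congr 2
    · ring
    · congr 1; linear_combination -hk2
  have e2 : gaussIntegral 1 √(1 - landen m) = (1 + k) / 2 * gaussIntegral 1 k := by
    have h := gaussIntegral_agm one_pos hk0
    have h' := gaussIntegral_const_mul (by positivity : 0 < 2 / (1 + k)) ((1 + k) / 2) √(1 * k)
    have e3 : 2 / (1 + k) * ((1 + k) / 2) = 1 := by field_simp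
    have e4 : √(1 - landen m) = 2 / (1 + k) * √(1 * k) := by
      have : 1 - landen m = (2 / (1 + k)) ^ 2 * k := by
        rw [hl]; field_simp; ring
      rw [this, Real.sqrt_mul (by positivity), Real.sqrt_sq (by positivity), one_mul]
    rw [e3, h] at h'
    rw [e4, h', inv_div]
  unfold realExponent
  rw [e1, e2, ← hk]
  have := gaussIntegral_pos one_pos hk0
  field_simp

/-- The numerator integral N lies within 4 of -(log m)/2, and the denominator is close enough to π/2
to put the exponent between 2N(1-m) and 2N. The factor 1-m costs only a bounded amount since m
log(1/m) ≤ 1. -/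
theorem abs_realExponent_add_log_le {m : ℝ} (h0 : 0 < m) (h1 : m ≤ 1 / 2) :
    |realExponent m + Real.log m| ≤ 8 := by
  have hs0 : 0 < √m := Real.sqrt_pos.2 h0
  have hs1 : √m ≤ 1 := by rw [Real.sqrt_le_one]; linarith
  have hlog : Real.log √m = Real.log m / 2 := Real.log_sqrt h0.le
  have hN1 := neg_log_le_gaussIntegral hs0
  have hN2 := gaussIntegral_le_neg_log hs0 hs1
  rw [gaussIntegral_comm] at hN1 hN2
  set N := gaussIntegral 1 √m with hN
  have hk0 : 0 < √(1 - m) := Real.sqrt_pos.2 (by linarith)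
  have hk1 : √(1 - m) ≤ 1 := by rw [Real.sqrt_le_one]; linarith
  have hk2 := Real.sq_sqrt (by linarith : 0 ≤ 1 - m)
  have hD1 := le_gaussIntegral_one hk0 hk1
  have hD2 := gaussIntegral_one_le hk0 hk1
  have hlm : 0 ≤ -Real.log m := by
    have := Real.log_nonpos h0.le (by linarith); linarith
  have hN0 : 0 ≤ N := by linarith
  unfold realExponent
  rw [← hN]
  set D := gaussIntegral 1 √(1 - m) with hD
  have hD0 : 0 < D := by linarith [Real.pi_pos]
  have hup : Real.pi * N / D ≤ 2 * N := by
    rw [div_le_iff₀ hD0]; nlinarith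
  have hlow : 2 * N * (1 - m) ≤ Real.pi * N / D := by
    rw [le_div_iff₀ hD0]
    have : (1 - m) * D ≤ Real.pi / 2 := by
      calc (1 - m) * D ≤ (1 - m) * (Real.pi / 2 * (√(1 - m))⁻¹) := by
            refine mul_le_mul_of_nonneg_left hD2 (by linarith)
        _ = Real.pi / 2 * √(1 - m) := by
            nth_rewrite 1 [← hk2]; field_simp
        _ ≤ _ := mul_le_of_le_one_right (by positivity) hk1
    nlinarith
  have hm : m * (-Real.log m) ≤ 1 := by
    have h := Real.log_le_sub_one_of_pos (inv_pos.2 h0)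
    rw [Real.log_inv] at h
    calc m * (-Real.log m) ≤ m * (m⁻¹ - 1) := by gcongr
      _ = 1 - m := by field_simp
      _ ≤ 1 := by linarith
  rw [abs_le]
  constructor
  · nlinarith
  · linarith

/-! ### Comparison of the exponent with the limit on `(0, 1)` -/

theorem csqrt_ofReal {x : ℝ} (hx : 0 ≤ x) : csqrt x = (√x : ℝ) := by
  rw [csqrt, Real.sqrt_eq_rpow, Complex.ofReal_cpow hx]
  push_cast; rfl

theorem psiOne_ofReal_sq {m : ℝ} (h1 : m < 1) : psiOne m ^ 2 = (landen m : ℝ) := by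
  have : (1 - (m : ℂ)) = ((1 - m : ℝ) : ℂ) := by push_cast; ring
  rw [psiOne, this, csqrt_ofReal (by linarith), landen]
  push_cast; ring

theorem psi_ofReal_nonneg (k : ℕ) {x : ℝ} (h0 : 0 ≤ x) (h1 : x ≤ 1) :
    ∃ y : ℝ, 0 ≤ y ∧ psi k x = y := by
  have hx : x ^ k ≤ 1 := pow_le_one₀ h0 h1
  refine ⟨x * (1 + √(1 - x ^ k)) ^ (-(2 : ℝ) / k), by positivity, ?_⟩
  have e : (1 - (x : ℂ) ^ k) = ((1 - x ^ k : ℝ) : ℂ) := by push_cast; ring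
  rw [psi, e, csqrt_ofReal (by linarith)]
  push_cast
  rw [Complex.ofReal_cpow (by positivity)]
  push_cast; rfl

theorem ofReal_mem_oneCutPlane {x : ℝ} (h : x < 1) : (x : ℂ) ∈ oneCutPlane := fun h' => by
  have := h'.2; rw [Complex.ofReal_re] at this; linarith

theorem psiComp_ofReal_nonneg (n : ℕ) {x : ℝ} (h0 : 0 ≤ x) (h1 : x < 1) :
    ∃ y : ℝ, 0 ≤ y ∧ psiComp n x = y := by
  induction n with
  | zero =>
    obtain ⟨y, hy, h⟩ := psi_ofReal_nonneg 1 h0 h1.le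
    exact ⟨y, hy, by rw [← h, psi_one]; rfl⟩
  | succ n ih =>
    obtain ⟨y, hy, h⟩ := ih
    have hlt := norm_psiComp_lt_one n (ofReal_mem_oneCutPlane h1)
    rw [h, Complex.norm_real, Real.norm_of_nonneg hy] at hlt
    obtain ⟨z, hz, h'⟩ := psi_ofReal_nonneg (2 ^ (n + 1)) hy hlt.le
    exact ⟨z, hz, by rw [← h', ← h]; rfl⟩

theorem psiLim_ofReal {x : ℝ} (h0 : 0 ≤ x) (h1 : x < 1) : psiLim x = (‖psiLim x‖ : ℝ) := by
  have h := tendsto_psiComp (ofReal_mem_oneCutPlane h1)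
  refine tendsto_nhds_unique h
    (((Complex.continuous_ofReal.tendsto _).comp h.norm).congr fun n => ?_)
  obtain ⟨y, hy, h⟩ := psiComp_ofReal_nonneg n h0 h1
  simp [h, abs_of_nonneg hy]

theorem abs_log_norm_psiLim_sub_log_le {m : ℝ} (h0 : 0 < m) (h1 : m < 1) :
    |Real.log ‖psiLim m‖ - Real.log m| ≤ Real.log 81 := by
  have hmem := ofReal_mem_oneCutPlane h1
  have hn : ‖(m : ℂ)‖ = m := by rw [Complex.norm_real, Real.norm_of_nonneg h0.le]
  have hle := (norm_psiLim_le hmem).trans (norm_psiOne_le m)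
  have hge := le_norm_psiLim hmem
  have hge' := le_norm_psiOne (ω := (m : ℂ)) (by rw [hn]; exact h1.le)
  rw [hn] at hle hge'
  have hpos : 0 < ‖psiLim m‖ := by linarith
  have h2 : Real.log ‖psiLim m‖ ≤ Real.log m := Real.log_le_log hpos hle
  -- One factor 1/9 is lost from m to `psiOne`, another from `psiOne` to `psiLim`.
  have h3 : Real.log (m / 81) ≤ Real.log ‖psiLim m‖ :=
    Real.log_le_log (by positivity) (by linarith)
  rw [Real.log_div h0.ne' (by norm_num)] at h3
  have := Real.log_pos (by norm_num : (1 : ℝ) < 81)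
  rw [abs_le]; constructor <;> linarith

/-- The discrepancy `f` of the two exponents doubles under `landen` and is bounded on (0, 1/2].
Landen iterates eventually enter this interval, so 2^n |f m| stays bounded and `f m` must be 0. -/
theorem exp_neg_realExponent {m : ℝ} (h0 : 0 < m) (h1 : m < 1) :
    Real.exp (-realExponent m) = ‖psiLim m‖ := by
  have hpos : ∀ m : ℝ, 0 < m → m < 1 → 0 < ‖psiLim m‖ := fun m h0 h1 =>
    norm_pos_iff.2 (psiLim_ne_zero (ofReal_mem_oneCutPlane h1) (by exact_mod_cast h0.ne'))
  set f : ℝ → ℝ := fun m => realExponent m + Real.log ‖psiLim m‖ with hf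
  have hdouble : ∀ m : ℝ, 0 < m → m < 1 → f (landen m) = 2 * f m := by
    intro m h0 h1
    simp only [hf]
    rw [realExponent_landen h0 h1, ← psiOne_ofReal_sq h1,
      ← psiLim_sq (ofReal_mem_oneCutPlane h1), norm_pow, Real.log_pow]
    push_cast; ring
  have hbound : ∀ m : ℝ, 0 < m → m ≤ 1 / 2 → |f m| ≤ 8 + Real.log 81 := by
    intro m h0 h1
    have e : f m = (realExponent m + Real.log m) + (Real.log ‖psiLim m‖ - Real.log m) := by
      simp only [hf]; ring
    rw [e]
    exact (abs_add_le _ _).trans (add_le_add (abs_realExponent_add_log_le h0 h1)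
      (abs_log_norm_psiLim_sub_log_le h0 (by linarith)))
  have hiter : ∀ n : ℕ, 0 < landen^[n] m ∧ landen^[n] m ≤ m ^ (n + 1) ∧
      f (landen^[n] m) = 2 ^ n * f m := by
    intro n
    induction n with
    | zero => simp [h0]
    | succ n ih =>
      obtain ⟨i1, i2, i3⟩ := ih
      have hlt : landen^[n] m ≤ m :=
        i2.trans (pow_le_of_le_one h0.le h1.le (Nat.succ_ne_zero n))
      rw [Function.iterate_succ_apply']
      refine ⟨landen_pos i1, ?_, ?_⟩
      · calc landen (landen^[n] m) ≤ (landen^[n] m) ^ 2 := landen_le_sq i1 (by linarith)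
          _ = landen^[n] m * landen^[n] m := sq _
          _ ≤ m ^ (n + 1) * m := by gcongr
          _ = m ^ (n + 1 + 1) := (pow_succ _ _).symm
      · rw [hdouble _ i1 (by linarith), i3]; ring
  have hzero : f m = 0 := by
    have hlim : Tendsto (fun n : ℕ => (8 + Real.log 81) * (1 / 2 : ℝ) ^ n) atTop (𝓝 0) := by
      simpa using (tendsto_pow_atTop_nhds_zero_of_lt_one (by norm_num : (0 : ℝ) ≤ 1 / 2)
        (by norm_num)).const_mul (8 + Real.log 81)
    have hsmall : ∀ᶠ n : ℕ in atTop, m ^ (n + 1) < 1 / 2 :=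
      ((tendsto_pow_atTop_nhds_zero_of_lt_one h0.le h1).comp
        (tendsto_add_atTop_nat 1)).eventually_lt_const (by norm_num)
    have : |f m| ≤ 0 := by
      refine ge_of_tendsto hlim ?_
      filter_upwards [hsmall] with n hn
      obtain ⟨i1, i2, i3⟩ := hiter n
      have := hbound _ i1 (i2.trans hn.le)
      rw [i3, abs_mul, abs_of_pos (by positivity)] at this
      rw [one_div, inv_pow, ← div_eq_mul_inv, le_div_iff₀ (by positivity)]
      linarith
    exact abs_nonpos_iff.1 this
  have : -realExponent m = Real.log ‖psiLim m‖ := by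
    simp only [hf] at hzero; linarith
  rw [this, Real.exp_log (hpos m h0 h1)]

theorem nome_ofReal {m : ℝ} (h0 : 0 < m) (h1 : m < 1) : nome m = psiLim m := by
  have hm0 : (m : ℂ) ≠ 0 := by exact_mod_cast h0.ne'
  have e : (1 - (m : ℂ)) = ((1 - m : ℝ) : ℂ) := by push_cast; ring
  rw [nome, if_neg hm0, psiLim_ofReal h0.le h1, ← exp_neg_realExponent h0 h1, e,
    ellK_ofReal h1, ellK_ofReal (by linarith), realExponent]
  push_cast
  congr 1
  rw [sub_sub_cancel]; ring

/-! ### The nome on the one-cut plane -/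

theorem one_sub_mul_sq_mem_slitPlane {m : ℂ} (hm : m ∈ oneCutPlane) {s : ℝ} (hs : s ^ 2 ≤ 1) :
    1 - m * (s : ℂ) ^ 2 ∈ Complex.slitPlane := by
  refine one_sub_mem_slitPlane ?_
  rintro ⟨h1, h2⟩
  have e : m * (s : ℂ) ^ 2 = m * ((s ^ 2 : ℝ) : ℂ) := by push_cast; ring
  rw [e, Complex.im_mul_ofReal] at h1
  rw [e, Complex.re_mul_ofReal] at h2
  rcases mul_eq_zero.1 h1 with h | h
  · refine hm ⟨h, ?_⟩
    by_contra! hlt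
    rcases le_total m.re 0 with h0 | h0 <;> nlinarith [sq_nonneg s]
  · rw [h] at h2; linarith

theorem one_sub_mul_sin_sq_mem_slitPlane {m : ℂ} (hm : m ∈ oneCutPlane) (θ : ℝ) :
    1 - m * ((Real.sin θ : ℝ) : ℂ) ^ 2 ∈ Complex.slitPlane :=
  one_sub_mul_sq_mem_slitPlane hm (Real.sin_sq_le_one θ)

theorem ellK_integrand_continuous {m : ℂ} (hm : m ∈ oneCutPlane) :
    Continuous fun θ : ℝ => (1 - m * ((Real.sin θ : ℝ) : ℂ) ^ 2) ^ (-(1 / 2) : ℂ) := by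
  refine Continuous.cpow (by fun_prop) continuous_const fun θ => ?_
  exact one_sub_mul_sin_sq_mem_slitPlane hm θ

theorem ellK_differentiableOn : DifferentiableOn ℂ ellK oneCutPlane := by
  intro m₀ hm₀
  obtain ⟨ε, hε, hball⟩ := Metric.nhds_basis_closedBall.mem_iff.1
    (isOpen_oneCutPlane.mem_nhds hm₀)
  set F' : ℂ → ℝ → ℂ := fun m θ =>
    (-(1 / 2) : ℂ) * (1 - m * ((Real.sin θ : ℝ) : ℂ) ^ 2) ^ (-(1 / 2) - 1 : ℂ) *
      (-((Real.sin θ : ℝ) : ℂ) ^ 2) with hF'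
  have hcont : ContinuousOn (fun p : ℂ × ℝ => F' p.1 p.2)
      (Metric.closedBall m₀ ε ×ˢ Set.Icc 0 (Real.pi / 2)) := by
    refine ContinuousOn.mul (ContinuousOn.mul continuousOn_const ?_) (by fun_prop)
    refine ContinuousOn.cpow (by fun_prop) continuousOn_const fun p hp => ?_
    exact one_sub_mul_sin_sq_mem_slitPlane (hball hp.1) _
  obtain ⟨C, hC⟩ := ((isCompact_closedBall m₀ ε).prod isCompact_Icc).exists_bound_of_continuousOn
    hcont
  have hle : (0 : ℝ) ≤ Real.pi / 2 := by positivity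
  have hF'c : Continuous (F' m₀) := by
    refine Continuous.mul (Continuous.mul continuous_const ?_) (by fun_prop)
    exact Continuous.cpow (by fun_prop) continuous_const
      fun θ => one_sub_mul_sin_sq_mem_slitPlane hm₀ θ
  have h := intervalIntegral.hasDerivAt_integral_of_dominated_loc_of_deriv_le (𝕜 := ℂ)
    (μ := volume) (a := 0) (b := Real.pi / 2) (x₀ := m₀) (bound := fun _ => C)
    (F := fun m θ => (1 - m * ((Real.sin θ : ℝ) : ℂ) ^ 2) ^ (-(1 / 2) : ℂ)) (F' := F')
    (Metric.closedBall_mem_nhds m₀ hε)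
    (by
      filter_upwards [isOpen_oneCutPlane.mem_nhds hm₀] with m hm
      exact (ellK_integrand_continuous hm).aestronglyMeasurable)
    ((ellK_integrand_continuous hm₀).intervalIntegrable _ _)
    hF'c.aestronglyMeasurable
    (Eventually.of_forall fun θ hθ m hm => hC (m, θ) ⟨hm, by
      rw [Set.uIoc_of_le hle] at hθ; exact Set.Ioc_subset_Icc_self hθ⟩)
    (by simp)
    (Eventually.of_forall fun θ _ m hm => by
      have h1 : HasDerivAt (fun m : ℂ => 1 - m * ((Real.sin θ : ℝ) : ℂ) ^ 2)
          (-((Real.sin θ : ℝ) : ℂ) ^ 2) m := by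
        simpa using ((hasDerivAt_id m).mul_const (((Real.sin θ : ℝ) : ℂ) ^ 2)).const_sub 1
      exact h1.cpow_const (one_sub_mul_sin_sq_mem_slitPlane (hball hm) θ))
  exact h.2.differentiableAt.differentiableWithinAt

/-- The integrand is the reciprocal of a square root with positive real part. Hence the denominator
in the nome never vanishes. -/
theorem ellK_re_pos {m : ℂ} (hm : m ∈ oneCutPlane) : 0 < (ellK m).re := by
  have hc := ellK_integrand_continuous hm
  have h := Complex.reCLM.intervalIntegral_comp_comm
    (hc.intervalIntegrable (μ := volume) 0 (Real.pi / 2))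
  have e : (ellK m).re = Complex.reCLM (ellK m) := rfl
  rw [e, ellK, ← h]
  refine intervalIntegral.intervalIntegral_pos_of_pos
    ((Complex.reCLM.continuous.comp hc).intervalIntegrable _ _) (fun θ => ?_) (by positivity)
  have hs := one_sub_mul_sin_sq_mem_slitPlane hm θ
  have h1 := csqrt_re_pos hs
  simp only [Complex.reCLM_apply]
  rw [Complex.cpow_neg, Complex.inv_re]
  exact div_pos h1 (Complex.normSq_pos.2 fun h0 => by rw [csqrt, h0] at h1; simp at h1)

theorem ellK_ne_zero {m : ℂ} (hm : m ∈ oneCutPlane) : ellK m ≠ 0 := fun h => by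
  have := ellK_re_pos hm
  rw [h] at this; simp at this

/-- The twice cut plane `ℂ \ ((-∞, 0] ∪ [1, ∞))`. -/
def twoCutPlane : Set ℂ := {ω | ω ∈ oneCutPlane ∧ 1 - ω ∈ oneCutPlane}

theorem isOpen_twoCutPlane : IsOpen twoCutPlane :=
  isOpen_oneCutPlane.inter (isOpen_oneCutPlane.preimage (by fun_prop))

theorem mem_twoCutPlane_of_im_ne_zero {ω : ℂ} (h : ω.im ≠ 0) : ω ∈ twoCutPlane :=
  ⟨fun h' => h h'.1, fun h' => h (by simpa using h'.1)⟩

theorem ofReal_mem_twoCutPlane {x : ℝ} (h0 : 0 < x) (h1 : x < 1) : (x : ℂ) ∈ twoCutPlane := by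
  refine ⟨ofReal_mem_oneCutPlane h1, ?_⟩
  have := ofReal_mem_oneCutPlane (by linarith : 1 - x < 1)
  simpa using this

theorem ne_zero_of_mem_twoCutPlane {ω : ℂ} (h : ω ∈ twoCutPlane) : ω ≠ 0 := by
  rintro rfl
  exact h.2 ⟨by simp, by simp⟩

theorem isPreconnected_twoCutPlane : IsPreconnected twoCutPlane := by
  have hstar : StarConvex ℝ ((1 / 2 : ℝ) : ℂ) twoCutPlane := by
    intro ω hω a b ha hb hab
    have hre : (a • ((1 / 2 : ℝ) : ℂ) + b • ω).re = a / 2 + b * ω.re := by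
      simp; ring
    have him : (a • ((1 / 2 : ℝ) : ℂ) + b • ω).im = b * ω.im := by simp
    constructor
    · rintro ⟨h1, h2⟩
      rw [him] at h1
      rw [hre] at h2
      rcases mul_eq_zero.1 h1 with h | h
      · subst h; linarith
      · have hb0 : 0 < b := lt_of_le_of_ne hb fun h => by subst h; linarith
        exact hω.1 ⟨h, by nlinarith⟩
    · rintro ⟨h1, h2⟩
      rw [Complex.sub_im, him] at h1
      rw [Complex.sub_re, hre] at h2
      simp only [Complex.one_im, Complex.one_re, zero_sub, neg_eq_zero] at h1 h2
      rcases mul_eq_zero.1 h1 with h | h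
      · subst h; linarith
      · have hb0 : 0 < b := lt_of_le_of_ne hb fun h => by subst h; linarith
        exact hω.2 ⟨by simpa using h, by simp; nlinarith⟩
  exact (hstar.isPathConnected
    (ofReal_mem_twoCutPlane (by norm_num) (by norm_num))).isConnected.isPreconnected

/-- The exponent `π K(1-ω) / K(ω)`. -/
def nomeExponent (ω : ℂ) : ℂ := Real.pi * ellK (1 - ω) / ellK ω

theorem nome_eq_exp {ω : ℂ} (h : ω ≠ 0) : nome ω = Complex.exp (-nomeExponent ω) := by
  rw [nome, if_neg h, nomeExponent]
  congr 1; ring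

theorem nomeExponent_differentiableOn : DifferentiableOn ℂ nomeExponent twoCutPlane := by
  refine DifferentiableOn.div (DifferentiableOn.const_mul ?_ _)
    (ellK_differentiableOn.mono fun _ h => h.1) fun ω h => ellK_ne_zero h.1
  exact ellK_differentiableOn.comp (by fun_prop) fun ω h => h.2

/-- Reflection swaps the two integrals and so inverts the exponent; this is how branches are carried
across [1, ∞). -/
theorem nomeExponent_one_sub {ω : ℂ} (h : ω ∈ twoCutPlane) :
    nomeExponent (1 - ω) = (Real.pi : ℂ) ^ 2 / nomeExponent ω := by
  have h1 := ellK_ne_zero h.1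
  have h2 := ellK_ne_zero h.2
  have h3 : (Real.pi : ℂ) ≠ 0 := by exact_mod_cast Real.pi_ne_zero
  rw [nomeExponent, nomeExponent, sub_sub_cancel]
  field_simp

theorem frequently_ofReal_near_half {p : ℂ → Prop} (hp : ∀ x : ℝ, 0 < x → x < 1 → p x) :
    ∃ᶠ z in 𝓝[≠] (((1 / 2 : ℝ) : ℂ)), p z := by
  have ht : Tendsto (fun x : ℝ => (x : ℂ)) (𝓝[≠] (1 / 2)) (𝓝[≠] (((1 / 2 : ℝ) : ℂ))) := by
    refine tendsto_nhdsWithin_of_tendsto_nhds_of_eventually_within _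
      ((Complex.continuous_ofReal.tendsto _).mono_left nhdsWithin_le_nhds) ?_
    filter_upwards [self_mem_nhdsWithin] with x hx
    exact fun h => hx (Complex.ofReal_injective h)
  refine ht.frequently (Eventually.frequently ?_)
  have : Set.Ioo (0 : ℝ) 1 ∈ 𝓝[≠] (1 / 2 : ℝ) :=
    mem_nhdsWithin_of_mem_nhds (Ioo_mem_nhds (by norm_num) (by norm_num))
  filter_upwards [this] with x hx
  exact hp x hx.1 hx.2

theorem nome_eq_psiLim_of_mem_twoCutPlane {ω : ℂ} (h : ω ∈ twoCutPlane) :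
    nome ω = psiLim ω := by
  have hd : DifferentiableOn ℂ nome twoCutPlane :=
    (nomeExponent_differentiableOn.neg.cexp).congr fun ω h =>
      nome_eq_exp (ne_zero_of_mem_twoCutPlane h)
  refine (hd.analyticOnNhd isOpen_twoCutPlane).eqOn_of_preconnected_of_frequently_eq
    ((psiLim_differentiableOn.mono fun _ h => h.1).analyticOnNhd isOpen_twoCutPlane)
    isPreconnected_twoCutPlane (ofReal_mem_twoCutPlane (by norm_num) (by norm_num))
    (frequently_ofReal_near_half fun x h0 h1 => nome_ofReal h0 h1) h

/-! ### Boundary values on the negative axis -/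

theorem intervalIntegrable_abs_sub_rpow (c a b : ℝ) :
    IntervalIntegrable (fun x => |x - c| ^ (-(1 / 2) : ℝ)) volume a b := by
  have h0 : ∀ t : ℝ, 0 ≤ t → IntervalIntegrable (fun x : ℝ => |x| ^ (-(1 / 2) : ℝ)) volume 0 t := by
    intro t ht
    refine (intervalIntegral.intervalIntegrable_rpow' (r := -(1 / 2)) (by norm_num)).congr
      fun x hx => ?_
    rw [Set.uIoc_of_le ht] at hx
    simp only [abs_of_pos hx.1]
  have h1 : ∀ t : ℝ, IntervalIntegrable (fun x : ℝ => |x| ^ (-(1 / 2) : ℝ)) volume 0 t := by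
    intro t
    rcases le_total 0 t with ht | ht
    · exact h0 t ht
    · have := (h0 (-t) (by linarith)).comp_sub_left 0
      simpa using this
  have h2 := ((h1 (a - c)).symm.trans (h1 (b - c))).comp_sub_right c
  simpa using h2

/-- Lower bound for the radicand `1 - M sin² θ` near its zero, for `M > 1`. -/
theorem exists_le_abs_one_sub_mul_sin_sq {M : ℝ} (hM : 1 < M) :
    ∃ c > 0, ∃ θ₀ : ℝ, ∀ θ ∈ Set.Icc 0 (Real.pi / 2),
      c * |θ - θ₀| ≤ |1 - M * Real.sin θ ^ 2| := by
  have hM0 : 0 < M := by linarith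
  have hs0 : 0 < √M⁻¹ := Real.sqrt_pos.2 (inv_pos.2 hM0)
  have hs1 : √M⁻¹ < 1 := by
    rw [Real.sqrt_lt' one_pos, one_pow]; exact inv_lt_one_of_one_lt₀ hM
  set θ₀ := Real.arcsin √M⁻¹ with hθ₀
  have hsin : Real.sin θ₀ = √M⁻¹ := Real.sin_arcsin (by linarith) hs1.le
  have hsq : Real.sin θ₀ ^ 2 = M⁻¹ := by rw [hsin, Real.sq_sqrt (inv_pos.2 hM0).le]
  have ht0 : 0 < θ₀ := Real.arcsin_pos.2 hs0
  have ht1 : θ₀ < Real.pi / 2 := Real.arcsin_lt_pi_div_two.2 hs1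
  have hcos : 0 < Real.cos θ₀ := Real.cos_pos_of_mem_Ioo ⟨by linarith, ht1⟩
  have hsinpos : 0 < Real.sin θ₀ := by rw [hsin]; exact hs0
  set c := min (Real.sin θ₀) (Real.cos θ₀) with hc
  have hc0 : 0 < c := lt_min hsinpos hcos
  have hpi := Real.pi_pos
  -- The radicand factors as M sin(θ₀-θ) sin(θ₀+θ). Jordan's inequality bounds the first sine below
  -- and yields 2/π; the second is at least `c` because sin θ + cos θ ≥ 1.
  refine ⟨M * (2 / Real.pi * c), by positivity, θ₀, fun θ hθ => ?_⟩
  have hsum : c ≤ Real.sin (θ₀ + θ) := by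
    have h1 : 0 ≤ Real.sin θ := Real.sin_nonneg_of_nonneg_of_le_pi hθ.1 (by linarith [hθ.2])
    have h2 : 0 ≤ Real.cos θ := Real.cos_nonneg_of_mem_Icc ⟨by linarith [hθ.1], hθ.2⟩
    have h3 : 1 ≤ Real.sin θ + Real.cos θ := by
      nlinarith [Real.sin_sq_add_cos_sq θ, mul_nonneg h1 h2]
    rw [Real.sin_add]
    have h4 : c ≤ Real.sin θ₀ := min_le_left _ _
    have h5 : c ≤ Real.cos θ₀ := min_le_right _ _
    nlinarith
  have hdiff : 2 / Real.pi * |θ - θ₀| ≤ |Real.sin (θ₀ - θ)| := by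
    rw [abs_sub_comm]
    rcases le_total 0 (θ₀ - θ) with h | h
    · rw [abs_of_nonneg h]
      exact (Real.mul_le_sin h (by linarith [hθ.1])).trans (le_abs_self _)
    · have h' := Real.mul_le_sin (x := -(θ₀ - θ)) (by linarith) (by linarith [hθ.2])
      rw [abs_of_nonpos h, ← abs_neg, ← Real.sin_neg]
      exact h'.trans (le_abs_self _)
  have e : 1 - M * Real.sin θ ^ 2 = M * (Real.sin (θ₀ - θ) * Real.sin (θ₀ + θ)) := by
    have h1 : Real.sin (θ₀ - θ) * Real.sin (θ₀ + θ) = Real.sin θ₀ ^ 2 - Real.sin θ ^ 2 := by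
      rw [Real.sin_sub, Real.sin_add]
      linear_combination (Real.sin θ₀ ^ 2) * (Real.sin_sq_add_cos_sq θ) -
        (Real.sin θ ^ 2) * (Real.sin_sq_add_cos_sq θ₀)
    rw [h1, hsq]; field_simp
  rw [e, abs_mul, abs_mul, abs_of_pos hM0, abs_of_pos (hc0.trans_le hsum), mul_assoc]
  refine mul_le_mul_of_nonneg_left ?_ hM0.le
  calc 2 / Real.pi * c * |θ - θ₀| = 2 / Real.pi * |θ - θ₀| * c := by ring
    _ ≤ |Real.sin (θ₀ - θ)| * Real.sin (θ₀ + θ) :=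
      mul_le_mul hdiff hsum hc0.le (abs_nonneg _)

theorem tendsto_cpow_neg_half {y : ℝ} (hy : y ≠ 0) {s : ℝ} (hs : 0 ≤ s) :
    Tendsto (fun ε : ℝ => ((y : ℂ) + (ε * s : ℝ) * Complex.I) ^ (-(1 / 2) : ℂ)) (𝓝[>] 0)
      (𝓝 ((y : ℂ) ^ (-(1 / 2) : ℂ))) := by
  have hbase : Tendsto (fun ε : ℝ => (y : ℂ) + (ε * s : ℝ) * Complex.I) (𝓝[>] 0) (𝓝 (y : ℂ)) := by
    have hc : Continuous fun ε : ℝ => (y : ℂ) + (ε * s : ℝ) * Complex.I := by fun_prop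
    simpa using (hc.tendsto 0).mono_left nhdsWithin_le_nhds
  have hlog : Tendsto (fun ε : ℝ => Complex.log ((y : ℂ) + (ε * s : ℝ) * Complex.I)) (𝓝[>] 0)
      (𝓝 (Complex.log y)) := by
    rcases lt_or_gt_of_ne hy with h | h
    · have hw := Complex.continuousWithinAt_log_of_re_neg_of_im_zero (z := (y : ℂ))
        (by simpa using h) (by simp)
      refine hw.tendsto.comp (tendsto_nhdsWithin_of_tendsto_nhds_of_eventually_within _ hbase ?_)
      filter_upwards [self_mem_nhdsWithin] with ε hε
      have : 0 < ε := hε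
      simp; positivity
    · exact (continuousAt_clog (Complex.ofReal_mem_slitPlane.2 h)).tendsto.comp hbase
  have hy' : (y : ℂ) ≠ 0 := by exact_mod_cast hy
  rw [Complex.cpow_def_of_ne_zero hy']
  refine ((Complex.continuous_exp.tendsto _).comp (hlog.mul_const (-(1 / 2) : ℂ))).congr' ?_
  filter_upwards [hbase.eventually_ne hy'] with ε hε
  rw [Function.comp_apply, Complex.cpow_def_of_ne_zero hε]

/-- Approaching the cut from below puts the radicand in the closed upper half plane, where the
principal power is continuous up to the negative axis. The singularity at the zero θ₀ of the
limiting radicand is dominated by the integrable |θ-θ₀|^{-1/2}. -/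
theorem tendsto_ellK_sub_mul_I {M : ℝ} (hM : 1 < M) :
    Tendsto (fun ε : ℝ => ellK ((M : ℂ) - ε * Complex.I)) (𝓝[>] 0) (𝓝 (ellK M)) := by
  obtain ⟨c, hc, θ₀, hθ₀⟩ := exists_le_abs_one_sub_mul_sin_sq hM
  have hle : (0 : ℝ) ≤ Real.pi / 2 := by positivity
  have e : ∀ ε θ : ℝ, 1 - ((M : ℂ) - ε * Complex.I) * ((Real.sin θ : ℝ) : ℂ) ^ 2 =
      ((1 - M * Real.sin θ ^ 2 : ℝ) : ℂ) + (ε * Real.sin θ ^ 2 : ℝ) * Complex.I := by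
    intro ε θ; push_cast; ring
  have hne : ∀ᵐ θ : ℝ, θ ≠ θ₀ := by simp [ae_iff]
  have hlow : ∀ θ ∈ Set.uIoc 0 (Real.pi / 2), c * |θ - θ₀| ≤ |1 - M * Real.sin θ ^ 2| := by
    intro θ hθ
    rw [Set.uIoc_of_le hle] at hθ
    exact hθ₀ θ (Set.Ioc_subset_Icc_self hθ)
  unfold ellK
  refine intervalIntegral.tendsto_integral_filter_of_dominated_convergence
    (fun θ => c ^ (-(1 / 2) : ℝ) * |θ - θ₀| ^ (-(1 / 2) : ℝ)) ?_ ?_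
    ((intervalIntegrable_abs_sub_rpow θ₀ _ _).const_mul _) ?_
  · filter_upwards [self_mem_nhdsWithin] with ε hε
    have hε : 0 < ε := hε
    refine (ellK_integrand_continuous ?_).aestronglyMeasurable
    rintro ⟨h, -⟩
    simp at h; linarith
  · refine Eventually.of_forall fun ε => ?_
    filter_upwards [hne] with θ hθ hmem
    have hpos : 0 < c * |θ - θ₀| := mul_pos hc (abs_pos.2 (sub_ne_zero.2 hθ))
    have e2 : (-(1 / 2) : ℂ) = ((-(1 / 2) : ℝ) : ℂ) := by push_cast; ring
    rw [e, e2, Complex.norm_cpow_real, ← Real.mul_rpow hc.le (abs_nonneg _)]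
    refine Real.rpow_le_rpow_of_nonpos hpos ((hlow θ hmem).trans ?_) (by norm_num)
    refine le_trans (le_of_eq ?_) (Complex.abs_re_le_norm _)
    simp [-Complex.ofReal_sub, -Complex.ofReal_mul, -Complex.ofReal_pow]
  · filter_upwards [hne] with θ hθ hmem
    have hpos : 0 < c * |θ - θ₀| := mul_pos hc (abs_pos.2 (sub_ne_zero.2 hθ))
    have hy : 1 - M * Real.sin θ ^ 2 ≠ 0 := abs_pos.1 (hpos.trans_le (hlow θ hmem))
    have h := tendsto_cpow_neg_half hy (sq_nonneg (Real.sin θ))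
    simp only [e]
    convert h using 2
    push_cast; rfl

/-- Both sides are limits along x + iε. This is the right side of the axis: 1-ω then approaches its
cut from below, where the principal value of `ellK` is the boundary value. -/
theorem nome_eq_psiLim_of_neg {x : ℝ} (hx : x < 0) : nome x = psiLim x := by
  have hmem := ofReal_mem_oneCutPlane (by linarith : x < 1)
  have hpath : Tendsto (fun ε : ℝ => (x : ℂ) + ε * Complex.I) (𝓝[>] 0) (𝓝 (x : ℂ)) := by
    have hc : Continuous fun ε : ℝ => (x : ℂ) + ε * Complex.I := by fun_prop
    simpa using (hc.tendsto 0).mono_left nhdsWithin_le_nhds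
  have h1 : Tendsto (fun ε : ℝ => psiLim ((x : ℂ) + ε * Complex.I)) (𝓝[>] 0) (𝓝 (psiLim x)) :=
    (psiLim_differentiableOn.differentiableAt
      (isOpen_oneCutPlane.mem_nhds hmem)).continuousAt.tendsto.comp hpath
  have h2 : Tendsto (fun ε : ℝ => ellK ((x : ℂ) + ε * Complex.I)) (𝓝[>] 0) (𝓝 (ellK x)) :=
    (ellK_differentiableOn.differentiableAt
      (isOpen_oneCutPlane.mem_nhds hmem)).continuousAt.tendsto.comp hpath
  have h3 : Tendsto (fun ε : ℝ => ellK (1 - ((x : ℂ) + ε * Complex.I))) (𝓝[>] 0)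
      (𝓝 (ellK (1 - x))) := by
    have := tendsto_ellK_sub_mul_I (by linarith : 1 < 1 - x)
    push_cast at this
    simpa only [sub_add_eq_sub_sub] using this
  have h4 := (Complex.continuous_exp.tendsto _).comp
    (((h3.const_mul (Real.pi : ℂ)).div h2 (ellK_ne_zero hmem)).neg)
  refine tendsto_nhds_unique ?_ h1
  rw [nome_eq_exp (by exact_mod_cast hx.ne)]
  refine h4.congr' ?_
  filter_upwards [self_mem_nhdsWithin] with ε hε
  have hε : 0 < ε := hε
  have hA : (x : ℂ) + ε * Complex.I ∈ twoCutPlane :=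
    mem_twoCutPlane_of_im_ne_zero (by simpa using hε.ne')
  rw [← nome_eq_psiLim_of_mem_twoCutPlane hA, nome_eq_exp (ne_zero_of_mem_twoCutPlane hA)]
  rfl

theorem nome_eqOn_psiLim : Set.EqOn nome psiLim oneCutPlane := by
  intro ω hω
  by_cases hA : ω ∈ twoCutPlane
  · exact nome_eq_psiLim_of_mem_twoCutPlane hA
  have him : ω.im = 0 := by
    by_contra h
    exact hA (mem_twoCutPlane_of_im_ne_zero h)
  have hω' : ω = (ω.re : ℂ) := Complex.ext (by simp) (by simpa using him)
  have hre : ω.re < 1 := by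
    by_contra! h
    exact hω ⟨him, h⟩
  rcases lt_trichotomy ω.re 0 with h | h | h
  · rw [hω']; exact nome_eq_psiLim_of_neg h
  · rw [hω', h, Complex.ofReal_zero, psiLim_zero, nome, if_pos rfl]
  · rw [hω']; exact nome_ofReal h hre

theorem tendstoUniformlyOn_psiComp_nome :
    TendstoUniformlyOn psiComp nome atTop oneCutPlane :=
  tendstoUniformlyOn_psiComp.congr_right nome_eqOn_psiLim.symm

theorem nome_differentiableOn : DifferentiableOn ℂ nome oneCutPlane :=
  psiLim_differentiableOn.congr nome_eqOn_psiLim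

/-! ### Logarithms of nonvanishing functions -/

/-- A primitive L of f'/f makes exp(-L) f constant, and the prescribed value at p makes the constant
1. -/
theorem exists_log_on_ball {f : ℂ → ℂ} {c : ℂ} {r : ℝ}
    (hf : DifferentiableOn ℂ f (Metric.ball c r)) (h0 : ∀ z ∈ Metric.ball c r, f z ≠ 0)
    {p y : ℂ} (hp : p ∈ Metric.ball c r) (hy : Complex.exp y = f p) :
    ∃ L : ℂ → ℂ, DifferentiableOn ℂ L (Metric.ball c r) ∧ L p = y ∧
      ∀ z ∈ Metric.ball c r, Complex.exp (L z) = f z := by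
  have hd : DifferentiableOn ℂ (fun z => deriv f z / f z) (Metric.ball c r) :=
    (hf.deriv Metric.isOpen_ball).div hf h0
  obtain ⟨L, hLp, hL⟩ := hd.isExactOn_ball.with_val_at p y
  have hfd : ∀ z ∈ Metric.ball c r, HasDerivAt f (deriv f z) z := fun z hz =>
    (hf.differentiableAt (Metric.isOpen_ball.mem_nhds hz)).hasDerivAt
  have hg : ∀ z ∈ Metric.ball c r, HasDerivAt (fun z => Complex.exp (-L z) * f z) 0 z := by
    intro z hz
    refine (((hL z hz).neg.cexp).mul (hfd z hz)).congr_deriv ?_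
    have := h0 z hz
    field_simp
    ring
  refine ⟨L, fun z hz => (hL z hz).differentiableAt.differentiableWithinAt, hLp, fun z hz => ?_⟩
  have hconst := Metric.isOpen_ball.is_const_of_deriv_eq_zero
    (convex_ball c r).isPreconnected
    (fun z hz => (hg z hz).differentiableAt.differentiableWithinAt)
    (fun z hz => (hg z hz).deriv) hz hp
  rw [hLp, ← hy, ← Complex.exp_add, neg_add_cancel, Complex.exp_zero, Complex.exp_neg] at hconst
  have := Complex.exp_ne_zero (L z)
  field_simp at hconst
  exact hconst.symm

/-- The periods 2πiℤ are discrete. This upgrades equality of exponentials to equality of logarithms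
wherever the limits agree. -/
theorem eventually_eq_zero_of_exp_eq_one {α : Type*} {l : Filter α} {d : α → ℂ}
    (hd : Tendsto d l (𝓝 0)) (h : ∀ᶠ x in l, Complex.exp (d x) = 1) : ∀ᶠ x in l, d x = 0 := by
  have him : Tendsto (fun x => (d x).im) l (𝓝 0) := by
    simpa [Function.comp_def] using (Complex.continuous_im.tendsto 0).comp hd
  filter_upwards [h, him.eventually_lt_const Real.pi_pos,
    him.eventually_const_lt (neg_lt_zero.2 Real.pi_pos)] with x h1 h2 h3
  rw [← Complex.log_exp h3 h2.le, h1, Complex.log_one]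

/-! ### The compositions as functions of the nome, near the origin -/

theorem zero_mem_oneCutPlane : (0 : ℂ) ∈ oneCutPlane :=
  mem_oneCutPlane_of_norm_lt_one (by simp)

theorem nome_zero : nome 0 = 0 := if_pos rfl

theorem nome_analyticAt {ω : ℂ} (h : ω ∈ oneCutPlane) : AnalyticAt ℂ nome ω :=
  nome_differentiableOn.analyticAt (isOpen_oneCutPlane.mem_nhds h)

theorem psiOne_analyticAt {ω : ℂ} (h : ω ∈ oneCutPlane) : AnalyticAt ℂ psiOne ω :=
  psiOne_differentiableOn.analyticAt (isOpen_oneCutPlane.mem_nhds h)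

theorem psiOne_zero : psiOne 0 = 0 := by
  simpa using norm_psiOne_le 0

theorem psiOne_eq_div (ω : ℂ) : psiOne ω = ω / (1 + csqrt (1 - ω)) ^ 2 := by
  have hne := one_add_csqrt_ne_zero (1 - ω)
  rw [psiOne, div_eq_div_iff hne (pow_ne_zero 2 hne)]
  linear_combination -(1 + csqrt (1 - ω)) * csqrt_sq (1 - ω)

theorem deriv_ne_zero_of_le_norm {f : ℂ → ℂ} {c : ℝ} (hc : 0 < c) (hf : DifferentiableAt ℂ f 0)
    (h0 : f 0 = 0) (h : ∀ᶠ z in 𝓝 (0 : ℂ), c * ‖z‖ ≤ ‖f z‖) : deriv f 0 ≠ 0 := by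
  have ht := hf.hasDerivAt.tendsto_slope.norm
  have : c ≤ ‖deriv f 0‖ := by
    refine ge_of_tendsto ht ?_
    filter_upwards [nhdsWithin_le_nhds h, self_mem_nhdsWithin] with z hz hz0
    have hz0 : z ≠ 0 := hz0
    rw [slope_def_field, h0, sub_zero, sub_zero, norm_div, le_div_iff₀ (norm_pos_iff.2 hz0)]
    exact hz
  exact norm_pos_iff.1 (hc.trans_le this)

theorem deriv_psiOne_ne_zero : deriv psiOne 0 ≠ 0 := by
  refine deriv_ne_zero_of_le_norm (c := 1 / 9) (by norm_num)
    (psiOne_analyticAt zero_mem_oneCutPlane).differentiableAt psiOne_zero ?_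
  filter_upwards [Metric.ball_mem_nhds (0 : ℂ) one_pos] with z hz
  rw [mem_ball_zero_iff] at hz
  linarith [le_norm_psiOne hz.le]

theorem deriv_nome_ne_zero : deriv nome 0 ≠ 0 := by
  refine deriv_ne_zero_of_le_norm (c := 1 / 81) (by norm_num)
    (nome_analyticAt zero_mem_oneCutPlane).differentiableAt nome_zero ?_
  filter_upwards [Metric.ball_mem_nhds (0 : ℂ) one_pos] with z hz
  rw [mem_ball_zero_iff] at hz
  have hm := mem_oneCutPlane_of_norm_lt_one hz
  rw [nome_eqOn_psiLim hm]
  linarith [le_norm_psiOne hz.le, le_norm_psiLim hm]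

theorem nome_sq {ω : ℂ} (h : ω ∈ oneCutPlane) : nome ω ^ 2 = nome (psiOne ω ^ 2) := by
  rw [nome_eqOn_psiLim h, nome_eqOn_psiLim (psiOne_sq_mem h), psiLim_sq h]

/-- A local inverse of the nome at the origin. -/
theorem exists_local_inverse_nome : ∃ lam : ℂ → ℂ, AnalyticAt ℂ lam 0 ∧ lam 0 = 0 ∧
    deriv lam 0 ≠ 0 ∧ (∀ᶠ q in 𝓝 (0 : ℂ), nome (lam q) = q) ∧
    ∀ᶠ m in 𝓝 (0 : ℂ), lam (nome m) = m := by
  have ha := nome_analyticAt zero_mem_oneCutPlane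
  have hs := ha.hasStrictDerivAt
  refine ⟨hs.localInverse nome _ 0 deriv_nome_ne_zero, ?_, ?_, ?_, ?_, ?_⟩
  · have := ha.analyticAt_localInverse deriv_nome_ne_zero
    rwa [nome_zero] at this
  · have := (hs.eventually_left_inverse deriv_nome_ne_zero).self_of_nhds
    rwa [nome_zero] at this
  · have := (hs.to_localInverse deriv_nome_ne_zero).hasDerivAt.deriv
    rw [nome_zero] at this
    rw [this]
    exact inv_ne_zero deriv_nome_ne_zero
  · have := hs.eventually_right_inverse deriv_nome_ne_zero
    rwa [nome_zero] at this
  · exact hs.eventually_left_inverse deriv_nome_ne_zero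

theorem csqrt_continuousAt {z : ℂ} (hz : z ∈ Complex.slitPlane) : ContinuousAt csqrt z :=
  continuousAt_id.cpow continuousAt_const hz

theorem csqrt_one : csqrt 1 = 1 := by simp [csqrt]

/-- Near the origin `ψ₁ = q exp (e q)`, where `q` is the nome and `e` is analytic and satisfies
Landen's functional equation. -/
theorem exists_log_psiOne_div_nome : ∃ e : ℂ → ℂ, AnalyticAt ℂ e 0 ∧
    Complex.exp (e 0) = 4 ∧
    (∀ᶠ m in 𝓝 (0 : ℂ), psiOne m = nome m * Complex.exp (e (nome m))) ∧
    (∀ᶠ q in 𝓝 (0 : ℂ), e (q ^ 2) / 2 = e q -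
      Complex.log (1 + csqrt (1 - (q * Complex.exp (e q)) ^ 2))) := by
  obtain ⟨lam, hlam, hlam0, hlam', hright, hleft⟩ := exists_local_inverse_nome
  have hpsi : AnalyticAt ℂ psiOne (lam 0) := by
    rw [hlam0]; exact psiOne_analyticAt zero_mem_oneCutPlane
  set G : ℂ → ℂ := fun q => psiOne (lam q) with hG
  have hGa : AnalyticAt ℂ G 0 := hpsi.comp hlam
  have hG0 : G 0 = 0 := by simp only [hG, hlam0, psiOne_zero]
  have hG' : deriv G 0 ≠ 0 := by
    have h := (hpsi.differentiableAt.hasDerivAt.comp 0 hlam.differentiableAt.hasDerivAt).deriv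
    have e : G = psiOne ∘ lam := rfl
    rw [e, h, hlam0]
    exact mul_ne_zero deriv_psiOne_ne_zero hlam'
  have hsq : Tendsto (fun q : ℂ => q ^ 2) (𝓝 0) (𝓝 0) := by
    have : Continuous fun q : ℂ => q ^ 2 := by fun_prop
    simpa using this.tendsto 0
  have hlamt : Tendsto lam (𝓝 0) (𝓝 0) := by
    simpa [hlam0] using hlam.continuousAt.tendsto
  have hGt : Tendsto G (𝓝 0) (𝓝 0) := by
    simpa [hG0] using hGa.continuousAt.tendsto
  have hG2t : Tendsto (fun q => G q ^ 2) (𝓝 0) (𝓝 0) := by simpa using hGt.pow 2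
  have hfun : ∀ᶠ q in 𝓝 (0 : ℂ), G (q ^ 2) = psiOne (G q ^ 2) := by
    filter_upwards [hright, hlamt.eventually (isOpen_oneCutPlane.mem_nhds zero_mem_oneCutPlane),
      hG2t.eventually hleft] with q h1 h2 h3
    simp only [hG] at h3 ⊢
    rw [← nome_sq h2, h1] at h3
    rw [h3]
  set E : ℂ → ℂ := dslope G 0 with hE
  have hGE : ∀ q, G q = q * E q := by
    intro q
    have := sub_smul_dslope G 0 q
    rw [hG0, sub_zero, sub_zero, smul_eq_mul] at this
    exact this.symm
  have hEa : AnalyticAt ℂ E 0 := by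
    obtain ⟨p, hp⟩ := hGa
    exact hp.has_fpower_series_dslope_fslope.analyticAt
  have hEt := hEa.continuousAt.tendsto
  have hct : Tendsto (fun q => 1 + csqrt (1 - G q ^ 2)) (𝓝 0) (𝓝 2) := by
    have h1 : Tendsto (fun q => 1 - G q ^ 2) (𝓝 0) (𝓝 1) := by
      simpa using hG2t.const_sub 1
    have h2 := ((csqrt_continuousAt Complex.one_mem_slitPlane).tendsto.comp h1).const_add 1
    rw [csqrt_one, one_add_one_eq_two] at h2
    exact h2
  have hEfun : ∀ᶠ q in 𝓝[≠] (0 : ℂ), E (q ^ 2) = E q ^ 2 / (1 + csqrt (1 - G q ^ 2)) ^ 2 := by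
    filter_upwards [nhdsWithin_le_nhds hfun, self_mem_nhdsWithin] with q h1 hq
    have hq : q ≠ 0 := hq
    rw [psiOne_eq_div, hGE, div_eq_mul_inv, hGE q] at h1
    have : q ^ 2 * E (q ^ 2) = q ^ 2 * (E q ^ 2 / (1 + csqrt (1 - G q ^ 2)) ^ 2) := by
      rw [h1, hGE q]; ring
    exact mul_left_cancel₀ (pow_ne_zero 2 hq) this
  -- Letting q → 0 in the equation for `E` gives E(0) = E(0)²/4, and E(0) is nonzero.
  have hE0 : E 0 = 4 := by
    have hne : E 0 ≠ 0 := by rw [hE, dslope_same]; exact hG'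
    have h1 : Tendsto (fun q => E (q ^ 2)) (𝓝[≠] 0) (𝓝 (E 0)) :=
      (hEt.comp hsq).mono_left nhdsWithin_le_nhds
    have h2 : Tendsto (fun q => E q ^ 2 / (1 + csqrt (1 - G q ^ 2)) ^ 2) (𝓝[≠] 0)
        (𝓝 (E 0 ^ 2 / 2 ^ 2)) :=
      ((hEt.pow 2).div (hct.pow 2) (by norm_num)).mono_left nhdsWithin_le_nhds
    have h3 := tendsto_nhds_unique (h1.congr' hEfun) h2
    field_simp at h3
    linear_combination -h3
  have hslit : E 0 ∈ Complex.slitPlane := by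
    rw [hE0]; exact Or.inl (by norm_num)
  set e : ℂ → ℂ := fun q => Complex.log (E q) with he
  have hea : AnalyticAt ℂ e 0 := hEa.clog hslit
  have hexp : ∀ᶠ q in 𝓝 (0 : ℂ), Complex.exp (e q) = E q := by
    filter_upwards [hEt.eventually_ne (by rw [hE0]; norm_num : E 0 ≠ 0)] with q hq
    exact Complex.exp_log hq
  have hnt : Tendsto nome (𝓝 0) (𝓝 0) := by
    simpa [nome_zero] using (nome_analyticAt zero_mem_oneCutPlane).continuousAt.tendsto
  refine ⟨e, hea, by rw [hexp.self_of_nhds, hE0], ?_, ?_⟩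
  · filter_upwards [hleft, hnt.eventually hexp] with m h1 h2
    rw [h2, ← hGE, hG]
    simp only [h1]
  -- The equation for `E` gives that for `e` only modulo 2πi; the ambiguity vanishes at the origin
  -- because log 4 = 2 log 2.
  · have hd : Tendsto (fun q => e (q ^ 2) - 2 * (e q - Complex.log (1 + csqrt (1 - G q ^ 2))))
        (𝓝 0) (𝓝 0) := by
      have h1 : Tendsto e (𝓝 0) (𝓝 (e 0)) := hea.continuousAt.tendsto
      have h2 : Tendsto (fun q => Complex.log (1 + csqrt (1 - G q ^ 2))) (𝓝 0)
          (𝓝 (Complex.log 2)) :=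
        (continuousAt_clog (Or.inl (by norm_num))).tendsto.comp hct
      have h3 := (h1.comp hsq).sub ((h1.sub h2).const_mul 2)
      have h4 : e 0 - 2 * (e 0 - Complex.log 2) = 0 := by
        have : Complex.log 4 = 2 * Complex.log 2 := by
          have h2 : (2 : ℂ) = ((2 : ℝ) : ℂ) := by norm_num
          have h4 : (4 : ℂ) = ((2 ^ 2 : ℝ) : ℂ) := by norm_num
          rw [h4, h2, ← Complex.ofReal_log (by norm_num), ← Complex.ofReal_log (by norm_num),
            Real.log_pow]
          push_cast; ring
        simp only [he, hE0, this]; ring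
      rw [h4] at h3
      exact h3
    have hone : ∀ᶠ q in 𝓝 (0 : ℂ), Complex.exp
        (e (q ^ 2) - 2 * (e q - Complex.log (1 + csqrt (1 - G q ^ 2)))) = 1 := by
      have hEfun' : ∀ᶠ q in 𝓝 (0 : ℂ),
          E (q ^ 2) = E q ^ 2 / (1 + csqrt (1 - G q ^ 2)) ^ 2 := by
        rw [eventually_nhdsWithin_iff] at hEfun
        filter_upwards [hEfun] with q hq
        rcases eq_or_ne q 0 with rfl | h
        · rw [hG0]; simp only [ne_eq, OfNat.ofNat_ne_zero, not_false_eq_true, zero_pow, sub_zero,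
            csqrt_one, hE0]; norm_num
        · exact hq h
      filter_upwards [hEfun', hexp, hsq.eventually hexp,
        hEt.eventually_ne (by rw [hE0]; norm_num : E 0 ≠ 0)] with q h1 h2 h3 h4
      have hc := one_add_csqrt_ne_zero (1 - G q ^ 2)
      have e2 : ∀ z : ℂ, Complex.exp (2 * z) = Complex.exp z ^ 2 := fun z => by
        rw [← Complex.exp_nat_mul]; norm_num
      rw [Complex.exp_sub, e2, Complex.exp_sub, h3, h2, Complex.exp_log hc, h1]
      field_simp
    filter_upwards [eventually_eq_zero_of_exp_eq_one hd hone, hexp] with q h1 h2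
    rw [h2, ← hGE]
    linear_combination h1 / 2

/-- The compositions are explicit functions of the nome near the origin, for every `e` with the
given germ. -/
theorem psiComp_eq_nome_mul_exp {e : ℂ → ℂ} (hstart :
    ∀ᶠ m in 𝓝 (0 : ℂ), psiOne m = nome m * Complex.exp (e (nome m)))
    (hfun : ∀ᶠ q in 𝓝 (0 : ℂ), e (q ^ 2) / 2 = e q -
      Complex.log (1 + csqrt (1 - (q * Complex.exp (e q)) ^ 2))) (n : ℕ) :
    ∀ᶠ m in 𝓝 (0 : ℂ),
      psiComp n m = nome m * Complex.exp (e (nome m ^ 2 ^ n) / 2 ^ n) := by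
  induction n with
  | zero => simpa [psiComp] using hstart
  | succ n ih =>
    have ht : Tendsto (fun m => nome m ^ 2 ^ n) (𝓝 0) (𝓝 0) := by
      have h := (nome_analyticAt zero_mem_oneCutPlane).continuousAt.tendsto.pow (2 ^ n)
      rwa [nome_zero, zero_pow (by positivity)] at h
    filter_upwards [ih, ht.eventually hfun] with m h1 h2
    set q := nome m with hq
    set Q := q ^ 2 ^ n with hQ
    have h2n : (2 : ℂ) ^ n ≠ 0 := pow_ne_zero n two_ne_zero
    -- Thus the square root inside the next factor is the one in Landen's equation at Q = q^{2^n}.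
    have hpow : psiComp n m ^ 2 ^ n = Q * Complex.exp (e Q) := by
      rw [h1, mul_pow, ← Complex.exp_nat_mul]
      congr 2
      push_cast; field_simp
    have hpow' : psiComp n m ^ 2 ^ (n + 1) = (Q * Complex.exp (e Q)) ^ 2 := by
      rw [pow_succ, pow_mul, hpow]
    have hcomp : psiComp (n + 1) m = psi (2 ^ (n + 1)) (psiComp n m) := rfl
    rw [hcomp, psi, hpow', Complex.cpow_def_of_ne_zero (one_add_csqrt_ne_zero _), h1, mul_assoc,
      ← Complex.exp_add]
    congr 2
    rw [pow_succ 2 n, pow_mul, ← hQ]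
    generalize Complex.log (1 + csqrt (1 - (Q * Complex.exp (e Q)) ^ 2)) = l at h2 ⊢
    have h3 : e (Q ^ 2) = 2 * (e Q - l) := by linear_combination 2 * h2
    rw [h3, pow_succ]
    push_cast
    field_simp
    ring

/-! ### Extension to the unit disk -/

/-- With G = q exp(e(q)), Landen's equation G(q)² = 4 G(q²)/(1+G(q²))² determines e at q by e at q²,
so the radius may grow from r to √r. The only obstruction is a zero of 1+G, excluded by G² ≠ 1. That
condition propagates, since G(q)² = 1 forces (1-G(q²))² = 0. -/
theorem exists_log_extension {e : ℂ → ℂ} {r ρ : ℝ} (hρ : 0 < ρ) (hr : ρ ^ 2 ≤ r)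
    (hd : DifferentiableOn ℂ e (Metric.ball 0 r)) (he0 : Complex.exp (e 0) = 4)
    (hland : ∀ᶠ q in 𝓝 (0 : ℂ), (q * Complex.exp (e q)) ^ 2 *
      (1 + q ^ 2 * Complex.exp (e (q ^ 2))) ^ 2 = 4 * (q ^ 2 * Complex.exp (e (q ^ 2))))
    (hne : ∀ q ∈ Metric.ball (0 : ℂ) r, (q * Complex.exp (e q)) ^ 2 ≠ 1) :
    ∃ e' : ℂ → ℂ, e' =ᶠ[𝓝 0] e ∧ DifferentiableOn ℂ e' (Metric.ball 0 ρ) ∧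
      ∀ q ∈ Metric.ball (0 : ℂ) ρ, (q * Complex.exp (e' q)) ^ 2 ≠ 1 := by
  set G : ℂ → ℂ := fun q => q * Complex.exp (e q) with hG
  have hr0 : 0 < r := lt_of_lt_of_le (by positivity) hr
  have hGd : DifferentiableOn ℂ G (Metric.ball 0 r) := differentiableOn_id.mul hd.cexp
  have hG1 : ∀ q ∈ Metric.ball (0 : ℂ) r, 1 + G q ≠ 0 := fun q hq h =>
    hne q hq (by
      have : q * Complex.exp (e q) = -1 := by
        simp only [hG] at h; linear_combination h
      rw [this]; norm_num)
  have h0r : (0 : ℂ) ∈ Metric.ball 0 r := Metric.mem_ball_self hr0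
  obtain ⟨L, hLd, hL0, hL⟩ := exists_log_on_ball (hGd.const_add 1) hG1 h0r
    (y := 0) (by simp [hG])
  have hmaps : Set.MapsTo (fun q : ℂ => q ^ 2) (Metric.ball 0 ρ) (Metric.ball 0 r) := by
    intro q hq
    rw [mem_ball_zero_iff] at hq ⊢
    rw [norm_pow]
    exact lt_of_lt_of_le (by gcongr) hr
  -- The term `e 0 / 2` is half a logarithm of 4, taken on the branch for which `e'` and `e` agree
  -- at 0.
  set e' : ℂ → ℂ := fun q => e 0 / 2 + e (q ^ 2) / 2 - L (q ^ 2) with he'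
  have he'd : DifferentiableOn ℂ e' (Metric.ball 0 ρ) := by
    have h1 := hd.comp (f := fun q : ℂ => q ^ 2) (by fun_prop) hmaps
    have h2 := hLd.comp (f := fun q : ℂ => q ^ 2) (by fun_prop) hmaps
    exact ((h1.div_const 2).const_add _).sub h2
  have e2 : ∀ z : ℂ, Complex.exp (2 * z) = Complex.exp z ^ 2 := fun z => by
    rw [← Complex.exp_nat_mul]; norm_num
  have hsq : ∀ q ∈ Metric.ball (0 : ℂ) ρ,
      Complex.exp (e' q) ^ 2 = 4 * Complex.exp (e (q ^ 2)) / (1 + G (q ^ 2)) ^ 2 := by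
    intro q hq
    have : 2 * e' q = e 0 + e (q ^ 2) - 2 * L (q ^ 2) := by simp only [he']; ring
    rw [← e2, this, Complex.exp_sub, Complex.exp_add, he0, e2, hL _ (hmaps hq)]
  have hρball := Metric.ball_mem_nhds (0 : ℂ) hρ
  refine ⟨e', ?_, he'd, ?_⟩
  · have hdiff : Tendsto (fun q => 2 * (e' q - e q)) (𝓝 0) (𝓝 0) := by
      have h1 := (he'd.differentiableAt hρball).continuousAt.tendsto
      have h2 := (hd.differentiableAt (Metric.ball_mem_nhds 0 hr0)).continuousAt.tendsto
      have h3 := (h1.sub h2).const_mul 2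
      have h4 : 2 * (e' 0 - e 0) = 0 := by simp [he', hL0]
      rwa [h4] at h3
    have hone : ∀ᶠ q in 𝓝 (0 : ℂ), Complex.exp (2 * (e' q - e q)) = 1 := by
      filter_upwards [hland, hρball] with q h1 hq
      rw [e2, Complex.exp_sub, div_pow, hsq q hq]
      have hne1 := hG1 _ (hmaps hq)
      have hne2 := Complex.exp_ne_zero (e q)
      rw [div_eq_one_iff_eq (pow_ne_zero 2 hne2), div_eq_iff (pow_ne_zero 2 hne1)]
      rcases eq_or_ne q 0 with rfl | hq0
      · simp only [hG]; simp [he0]; norm_num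
      · refine mul_left_cancel₀ (pow_ne_zero 2 hq0) ?_
        simp only [hG]
        linear_combination -h1
    filter_upwards [eventually_eq_zero_of_exp_eq_one hdiff hone] with q h1
    linear_combination h1 / 2
  · intro q hq h1
    have hne1 := hG1 _ (hmaps hq)
    rw [mul_pow, hsq q hq, mul_div_assoc', div_eq_iff (pow_ne_zero 2 hne1), one_mul] at h1
    have h2 : (1 - G (q ^ 2)) ^ 2 = 0 := by
      have : G (q ^ 2) = q ^ 2 * Complex.exp (e (q ^ 2)) := rfl
      linear_combination -h1 - 4 * this
    have h3 : G (q ^ 2) = 1 := by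
      have := pow_eq_zero_iff (two_ne_zero) |>.1 h2
      linear_combination -this
    refine hne _ (hmaps hq) ?_
    have : q ^ 2 * Complex.exp (e (q ^ 2)) = 1 := h3
    rw [this, one_pow]

/-- The germ is analytic with G² ≠ 1 on some disk of radius ε. Since ρ^{2^n} < ε for some n, n
extensions by Landen's equation reach radius ρ. -/
theorem exists_log_on_disk {ρ : ℝ} (hρ : 0 < ρ) (hρ1 : ρ < 1) :
    ∃ e : ℂ → ℂ, DifferentiableOn ℂ e (Metric.ball 0 ρ) ∧ ∀ n, ∀ᶠ m in 𝓝 (0 : ℂ),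
      psiComp n m = nome m * Complex.exp (e (nome m ^ 2 ^ n) / 2 ^ n) := by
  obtain ⟨e₀, ha, he0, hstart, hfun⟩ := exists_log_psiOne_div_nome
  have hsqt : Tendsto (fun q : ℂ => q ^ 2) (𝓝 0) (𝓝 0) := by
    have : Continuous fun q : ℂ => q ^ 2 := by fun_prop
    simpa using this.tendsto 0
  -- Eliminating the square root c makes Landen's equation rational, free of any choice of branch.
  have hland : ∀ᶠ q in 𝓝 (0 : ℂ), (q * Complex.exp (e₀ q)) ^ 2 *
      (1 + q ^ 2 * Complex.exp (e₀ (q ^ 2))) ^ 2 = 4 * (q ^ 2 * Complex.exp (e₀ (q ^ 2))) := by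
    filter_upwards [hfun] with q h
    set G := q * Complex.exp (e₀ q) with hG
    have hc := one_add_csqrt_ne_zero (1 - G ^ 2)
    have hc2 := csqrt_sq (1 - G ^ 2)
    set c := csqrt (1 - G ^ 2) with hcdef
    have h1 : e₀ (q ^ 2) = 2 * (e₀ q - Complex.log (1 + c)) := by linear_combination 2 * h
    have e2 : ∀ z : ℂ, Complex.exp (2 * z) = Complex.exp z ^ 2 := fun z => by
      rw [← Complex.exp_nat_mul]; norm_num
    have h2 : q ^ 2 * Complex.exp (e₀ (q ^ 2)) = G ^ 2 / (1 + c) ^ 2 := by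
      rw [h1, e2, Complex.exp_sub, Complex.exp_log hc, hG]; field_simp
    have h3 : 1 + G ^ 2 / (1 + c) ^ 2 = 2 / (1 + c) := by
      field_simp; linear_combination hc2
    rw [h2, h3]
    field_simp; norm_num
  have key : ∀ n : ℕ, ∀ ρ : ℝ, ∀ ε : ℝ, 0 < ρ → ρ < 1 → ρ ^ 2 ^ n ≤ ε →
      (DifferentiableOn ℂ e₀ (Metric.ball 0 ε) ∧
        ∀ q ∈ Metric.ball (0 : ℂ) ε, (q * Complex.exp (e₀ q)) ^ 2 ≠ 1) →
      ∃ e : ℂ → ℂ, e =ᶠ[𝓝 0] e₀ ∧ DifferentiableOn ℂ e (Metric.ball 0 ρ) ∧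
        ∀ q ∈ Metric.ball (0 : ℂ) ρ, (q * Complex.exp (e q)) ^ 2 ≠ 1 := by
    intro n
    induction n with
    | zero =>
      intro ρ ε _ _ hle hε
      rw [pow_zero, pow_one] at hle
      have hsub := Metric.ball_subset_ball (x := (0 : ℂ)) hle
      exact ⟨e₀, EventuallyEq.rfl, hε.1.mono hsub, fun q hq => hε.2 q (hsub hq)⟩
    | succ n ih =>
      intro ρ ε h0 h1 hle hε
      rw [pow_succ', pow_mul] at hle
      obtain ⟨e, hee, hd, hne⟩ := ih (ρ ^ 2) ε (by positivity)
        (pow_lt_one₀ h0.le h1 two_ne_zero) hle hε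
      obtain ⟨e', he', hd', hne'⟩ := exists_log_extension h0 le_rfl hd
        (by rw [hee.self_of_nhds, he0])
        (by
          filter_upwards [hland, hee, hsqt.eventually hee] with q h1 h2 h3
          rw [h2, h3]; exact h1) hne
      exact ⟨e', he'.trans hee, hd', hne'⟩
  obtain ⟨ε, hε, hball⟩ := Metric.mem_nhds_iff.1
    (ha.eventually_analyticAt.and
      ((((continuousAt_id.mul ha.continuousAt.cexp).pow 2).eventually_ne
        (by simp : (id (0 : ℂ) * Complex.exp (e₀ 0)) ^ 2 ≠ 1))))
  have hpow : Tendsto (fun n : ℕ => ρ ^ 2 ^ n) atTop (𝓝 0) :=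
    (tendsto_pow_atTop_nhds_zero_of_lt_one hρ.le hρ1).comp
      (tendsto_pow_atTop_atTop_of_one_lt one_lt_two)
  obtain ⟨n, hn⟩ := (hpow.eventually_lt_const hε).exists
  obtain ⟨e, hee, hd, -⟩ := key n ρ ε hρ hρ1 hn.le
    ⟨fun q hq => (hball hq).1.differentiableAt.differentiableWithinAt, fun q hq => (hball hq).2⟩
  have hnt : Tendsto nome (𝓝 0) (𝓝 0) := by
    simpa [nome_zero] using (nome_analyticAt zero_mem_oneCutPlane).continuousAt.tendsto
  refine ⟨e, hd, psiComp_eq_nome_mul_exp ?_ ?_⟩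
  · filter_upwards [hstart, hnt.eventually hee] with m h1 h2
    rw [h2, h1]
  · filter_upwards [hfun, hee, hsqt.eventually hee] with q h1 h2 h3
    rw [h2, h3, h1]

/-! ### Branches of the nome -/

/-- `f` is, near `p`, a holomorphic function from the right half plane to the unit disk, applied
to a branch of `-log nome`. -/
def IsLogBranch (f : ℂ → ℂ) (p : ℂ) : Prop :=
  p ∈ oneCutPlane ∧ p ≠ 0 ∧ ∃ T w : ℂ → ℂ, DifferentiableOn ℂ T {z | 0 < z.re} ∧
    (∀ z, 0 < z.re → ‖T z‖ < 1) ∧ AnalyticAt ℂ w p ∧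
    (∀ᶠ z in 𝓝 p, Complex.exp (-w z) = nome z) ∧ f =ᶠ[𝓝 p] T ∘ w

/-- The germs that arise from the nome by analytic continuation are of this form: the reflection
`ω ↦ 1 - ω` exchanges the two singular points. -/
def IsNomeBranch (f : ℂ → ℂ) (p : ℂ) : Prop :=
  IsLogBranch f p ∨ IsLogBranch (fun z => f (1 - z)) (1 - p)

theorem isOpen_re_pos : IsOpen {z : ℂ | 0 < z.re} :=
  isOpen_lt continuous_const Complex.continuous_re

theorem norm_nome_lt_one {ω : ℂ} (h : ω ∈ oneCutPlane) : ‖nome ω‖ < 1 := by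
  rw [nome_eqOn_psiLim h]; exact norm_psiLim_lt_one h

theorem nome_ne_zero {ω : ℂ} (h : ω ∈ oneCutPlane) (h0 : ω ≠ 0) : nome ω ≠ 0 := by
  rw [nome_eqOn_psiLim h]; exact psiLim_ne_zero h h0

theorem re_pos_of_exp_neg_eq_nome {w ω : ℂ} (h : ω ∈ oneCutPlane)
    (hw : Complex.exp (-w) = nome ω) : 0 < w.re := by
  have h1 := norm_nome_lt_one h
  rw [← hw, Complex.norm_exp, Real.exp_lt_one_iff, Complex.neg_re] at h1
  linarith

theorem IsLogBranch.analyticAt {f : ℂ → ℂ} {p : ℂ} (h : IsLogBranch f p) : AnalyticAt ℂ f p := by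
  obtain ⟨hp, -, T, w, hT, -, hw, hexp, hf⟩ := h
  have hre := re_pos_of_exp_neg_eq_nome hp hexp.self_of_nhds
  exact ((hT.analyticAt (isOpen_re_pos.mem_nhds hre)).comp hw).congr hf.symm

theorem IsLogBranch.norm_lt_one {f : ℂ → ℂ} {p : ℂ} (h : IsLogBranch f p) : ‖f p‖ < 1 := by
  obtain ⟨hp, -, T, w, -, hT1, hw, hexp, hf⟩ := h
  rw [hf.self_of_nhds]
  exact hT1 _ (re_pos_of_exp_neg_eq_nome hp hexp.self_of_nhds)

/-- Near p the branch w is `nomeExponent` plus a period d, and reflection inverts `nomeExponent`. So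
T is replaced by u ↦ T(π²/u + d), where the inner map preserves the right half plane because d is
purely imaginary. -/
theorem isLogBranch_one_sub {f : ℂ → ℂ} {p : ℂ} (h : IsLogBranch f p) (hp : 1 - p ∈ oneCutPlane) :
    IsLogBranch (fun z => f (1 - z)) (1 - p) := by
  obtain ⟨hp0, hpne, T, w, hT, hT1, hw, hexp, hf⟩ := h
  have hA : p ∈ twoCutPlane := ⟨hp0, hp⟩
  have hA' : 1 - p ∈ twoCutPlane := ⟨hp, by rwa [sub_sub_cancel]⟩
  have hWa : ∀ ω ∈ twoCutPlane, AnalyticAt ℂ nomeExponent ω := fun ω h =>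
    nomeExponent_differentiableOn.analyticAt (isOpen_twoCutPlane.mem_nhds h)
  have hWexp : ∀ ω ∈ twoCutPlane, Complex.exp (-nomeExponent ω) = nome ω := fun ω h =>
    (nome_eq_exp (ne_zero_of_mem_twoCutPlane h)).symm
  have hWre : ∀ ω ∈ twoCutPlane, 0 < (nomeExponent ω).re := fun ω h =>
    re_pos_of_exp_neg_eq_nome h.1 (hWexp ω h)
  set d : ℂ := w p - nomeExponent p with hd
  have hdexp : Complex.exp d = 1 := by
    have h1 := hexp.self_of_nhds
    rw [← hWexp p hA] at h1
    have : d = -nomeExponent p - -w p := by rw [hd]; ring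
    rw [this, Complex.exp_sub, h1, div_self (Complex.exp_ne_zero _)]
  have hdre : d.re = 0 := by
    have := congrArg norm hdexp
    rwa [Complex.norm_exp, norm_one, Real.exp_eq_one_iff] at this
  have hwW : ∀ᶠ z in 𝓝 p, w z = nomeExponent z + d := by
    have ht : Tendsto (fun z => w z - nomeExponent z - d) (𝓝 p) (𝓝 0) := by
      have := (hw.continuousAt.tendsto.sub (hWa p hA).continuousAt.tendsto).sub_const d
      rwa [← hd, sub_self] at this
    have h1 : ∀ᶠ z in 𝓝 p, Complex.exp (w z - nomeExponent z - d) = 1 := by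
      filter_upwards [hexp, isOpen_twoCutPlane.mem_nhds hA] with z h2 h3
      rw [← hWexp z h3] at h2
      have : w z - nomeExponent z - d = (-nomeExponent z - -w z) - d := by ring
      rw [this, Complex.exp_sub, hdexp, Complex.exp_sub, h2, div_one,
        div_self (Complex.exp_ne_zero _)]
    filter_upwards [eventually_eq_zero_of_exp_eq_one ht h1] with z h2
    linear_combination h2
  have hre : ∀ u : ℂ, 0 < u.re → 0 < ((Real.pi : ℂ) ^ 2 / u + d).re := by
    intro u hu
    have e : (Real.pi : ℂ) ^ 2 / u = ((Real.pi ^ 2 : ℝ) : ℂ) * u⁻¹ := by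
      push_cast; rw [div_eq_mul_inv]
    rw [Complex.add_re, hdre, add_zero, e, Complex.re_ofReal_mul, Complex.inv_re]
    have hu0 : u ≠ 0 := fun h => by rw [h] at hu; simp at hu
    have := Complex.normSq_pos.2 hu0
    have := Real.pi_pos
    positivity
  refine ⟨hp, ne_zero_of_mem_twoCutPlane hA', fun u => T ((Real.pi : ℂ) ^ 2 / u + d), nomeExponent,
    ?_, fun u hu => hT1 _ (hre u hu), hWa _ hA', ?_, ?_⟩
  · refine hT.comp ?_ fun u hu => hre u hu
    refine ((differentiableOn_const _).div differentiableOn_id fun u hu h => ?_).add_const d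
    have hu : 0 < u.re := hu
    have h : u = 0 := h
    rw [h] at hu; simp at hu
  · filter_upwards [isOpen_twoCutPlane.mem_nhds hA'] with z hz using hWexp z hz
  · have ht : Tendsto (fun z : ℂ => 1 - z) (𝓝 (1 - p)) (𝓝 p) := by
      have : Continuous fun z : ℂ => 1 - z := by fun_prop
      simpa using this.tendsto (1 - p)
    filter_upwards [ht.eventually hwW, ht.eventually hf,
      isOpen_twoCutPlane.mem_nhds hA'] with z h1 h2 h3
    have h4 := nomeExponent_one_sub h3
    simp only [Function.comp_apply] at h2 ⊢
    rw [h2, h1, h4]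

/-- Only w needs continuing, and a logarithm of the nonvanishing nome exists on the whole ball. T
remains applicable since |nome| < 1 keeps w in the right half plane. -/
theorem IsLogBranch.exists_extension {f : ℂ → ℂ} {c p : ℂ} {r : ℝ}
    (hball : Metric.ball c r ⊆ oneCutPlane \ {0}) (hp : p ∈ Metric.ball c r)
    (h : IsLogBranch f p) :
    ∃ g : ℂ → ℂ, g =ᶠ[𝓝 p] f ∧ ∀ z ∈ Metric.ball c r, IsLogBranch g z := by
  obtain ⟨hp0, hpne, T, w, hT, hT1, hw, hexp, hf⟩ := h
  obtain ⟨L, hLd, hLp, hL⟩ := exists_log_on_ball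
    (nome_differentiableOn.mono fun z hz => (hball hz).1)
    (fun z hz => nome_ne_zero (hball hz).1 (hball hz).2) hp (y := -w p) hexp.self_of_nhds
  have hLa : ∀ z ∈ Metric.ball c r, AnalyticAt ℂ L z := fun z hz =>
    hLd.analyticAt (Metric.isOpen_ball.mem_nhds hz)
  have hpnhds := Metric.isOpen_ball.mem_nhds hp
  have hLw : ∀ᶠ z in 𝓝 p, L z + w z = 0 := by
    refine eventually_eq_zero_of_exp_eq_one ?_ ?_
    · have := (hLa p hp).continuousAt.tendsto.add hw.continuousAt.tendsto
      rwa [hLp, neg_add_cancel] at this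
    · filter_upwards [hexp, hpnhds] with z h1 h2
      rw [Complex.exp_add, hL z h2, ← h1, ← Complex.exp_add, neg_add_cancel, Complex.exp_zero]
  refine ⟨fun z => T (-L z), ?_, fun z hz => ⟨(hball hz).1, (hball hz).2, T, fun z => -L z, hT,
    hT1, (hLa z hz).neg, ?_, EventuallyEq.rfl⟩⟩
  · filter_upwards [hLw, hf] with z h1 h2
    rw [h2, Function.comp_apply, eq_neg_of_add_eq_zero_left h1, neg_neg]
  · filter_upwards [Metric.isOpen_ball.mem_nhds hz] with y hy
    rw [neg_neg, hL y hy]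

theorem isLogBranch_nome {p : ℂ} (hp : p ∈ oneCutPlane) (h0 : p ≠ 0) : IsLogBranch nome p := by
  obtain ⟨r, hr, hball⟩ := Metric.isOpen_iff.1
    (isOpen_oneCutPlane.sdiff isClosed_singleton) p ⟨hp, h0⟩
  have hpb : p ∈ Metric.ball p r := Metric.mem_ball_self hr
  obtain ⟨L, hLd, -, hL⟩ := exists_log_on_ball
    (nome_differentiableOn.mono fun z hz => (hball hz).1)
    (fun z hz => nome_ne_zero (hball hz).1 (hball hz).2) hpb
    (Complex.exp_log (nome_ne_zero hp h0))
  have hnhds := Metric.isOpen_ball.mem_nhds hpb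
  refine ⟨hp, h0, fun u => Complex.exp (-u), fun z => -L z, by fun_prop, fun u hu => ?_,
    (hLd.analyticAt hnhds).neg, ?_, ?_⟩
  · rw [Complex.norm_exp, Real.exp_lt_one_iff, Complex.neg_re]; linarith
  · filter_upwards [hnhds] with z hz
    rw [neg_neg, hL z hz]
  · filter_upwards [hnhds] with z hz
    rw [Function.comp_apply, neg_neg, hL z hz]

theorem IsNomeBranch.analyticAt {f : ℂ → ℂ} {p : ℂ} (h : IsNomeBranch f p) :
    AnalyticAt ℂ f p := by
  rcases h with h | h
  · exact h.analyticAt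
  · have h1 : AnalyticAt ℂ (fun z : ℂ => 1 - z) p := by fun_prop
    have h2 := h.analyticAt.comp (g := fun z => f (1 - z)) (f := fun z : ℂ => 1 - z) h1
    simpa [Function.comp_def] using h2

theorem IsNomeBranch.norm_lt_one {f : ℂ → ℂ} {p : ℂ} (h : IsNomeBranch f p) : ‖f p‖ < 1 := by
  rcases h with h | h
  · exact h.norm_lt_one
  · simpa using h.norm_lt_one

theorem IsNomeBranch.one_sub {f : ℂ → ℂ} {p : ℂ} (h : IsNomeBranch f p) :
    IsNomeBranch (fun z => f (1 - z)) (1 - p) := by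
  rcases h with h | h
  · exact Or.inr (by simpa using h)
  · exact Or.inl h

theorem IsNomeBranch.isLogBranch {f : ℂ → ℂ} {p : ℂ} (h : IsNomeBranch f p)
    (hp : p ∈ oneCutPlane) : IsLogBranch f p := by
  rcases h with h | h
  · exact h
  · simpa using isLogBranch_one_sub h (by simpa using hp)

/-- Every point other than `0` and `1` has a neighbourhood to which all branches of the nome that
are defined somewhere in it extend. -/
theorem exists_ball_extension {c : ℂ} (h0 : c ≠ 0) (h1 : c ≠ 1) :
    ∃ r > 0, ∀ p ∈ Metric.ball c r, ∀ f, IsNomeBranch f p →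
      ∃ g : ℂ → ℂ, g =ᶠ[𝓝 p] f ∧ ∀ z ∈ Metric.ball c r, IsNomeBranch g z := by
  have main : ∀ c : ℂ, c ∈ oneCutPlane → c ≠ 0 → ∃ r > 0, ∀ p ∈ Metric.ball c r, ∀ f,
      IsNomeBranch f p →
      ∃ g : ℂ → ℂ, g =ᶠ[𝓝 p] f ∧ ∀ z ∈ Metric.ball c r, IsNomeBranch g z := by
    intro c hc h0
    obtain ⟨r, hr, hball⟩ := Metric.isOpen_iff.1
      (isOpen_oneCutPlane.sdiff isClosed_singleton) c ⟨hc, h0⟩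
    refine ⟨r, hr, fun p hp f hf => ?_⟩
    obtain ⟨g, hg, hgb⟩ := (hf.isLogBranch (hball hp).1).exists_extension hball hp
    exact ⟨g, hg, fun z hz => Or.inl (hgb z hz)⟩
  by_cases hc : c ∈ oneCutPlane
  · exact main c hc h0
  · have hc' : 1 - c ∈ oneCutPlane := by
      rintro ⟨h2, h3⟩
      refine hc fun h4 => h0 (Complex.ext ?_ h4.1)
      simp at h3 ⊢
      linarith [h4.2]
    obtain ⟨r, hr, h⟩ := main (1 - c) hc' (sub_ne_zero.2 h1.symm)
    have hmem : ∀ z, z ∈ Metric.ball c r → 1 - z ∈ Metric.ball (1 - c) r := by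
      intro z hz
      rw [Metric.mem_ball, dist_eq_norm] at hz ⊢
      rwa [show 1 - z - (1 - c) = -(z - c) by ring, norm_neg]
    refine ⟨r, hr, fun p hp f hf => ?_⟩
    obtain ⟨g, hg, hgb⟩ := h (1 - p) (hmem p hp) _ hf.one_sub
    refine ⟨fun z => g (1 - z), ?_, fun z hz => ?_⟩
    · have ht : Tendsto (fun z : ℂ => 1 - z) (𝓝 p) (𝓝 (1 - p)) :=
        (by fun_prop : Continuous fun z : ℂ => 1 - z).tendsto p
      filter_upwards [ht.eventually hg] with z hz
      rw [hz, sub_sub_cancel]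
    · simpa using (hgb (1 - z) (hmem z hz)).one_sub

/-! ### Continuation along curves -/

open unitInterval

/-- A continuation of the nome along the part of `γ` up to the time `τ`. -/
def IsNomeContinuationUpTo (γ : C(I, ℂ)) (τ : I) (F : I → ℂ → ℂ) : Prop :=
  F 0 =ᶠ[𝓝 0] nome ∧ (∀ t ≤ τ, t ≠ 0 → IsNomeBranch (F t) (γ t)) ∧
    ∀ t ≤ τ, ∀ᶠ s in 𝓝 t, s ≤ τ → F s =ᶠ[𝓝 (γ s)] F t

theorem IsNomeContinuationUpTo.extend {γ : C(I, ℂ)} {τ τ' : I} {F : I → ℂ → ℂ}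
    (h : IsNomeContinuationUpTo γ τ F) (hτ : 0 < τ) (hle : τ ≤ τ') {c : ℂ} {r : ℝ}
    (hext : ∀ p ∈ Metric.ball c r, ∀ f, IsNomeBranch f p →
      ∃ g : ℂ → ℂ, g =ᶠ[𝓝 p] f ∧ ∀ z ∈ Metric.ball c r, IsNomeBranch g z)
    (hγ : ∀ s ∈ Set.Icc τ τ', γ s ∈ Metric.ball c r) :
    ∃ F', IsNomeContinuationUpTo γ τ' F' := by
  classical
  obtain ⟨h0, hbranch, hcoh⟩ := h
  obtain ⟨g, hg, hgb⟩ := hext (γ τ) (hγ τ ⟨le_rfl, hle⟩) (F τ) (hbranch τ le_rfl hτ.ne')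
  refine ⟨fun s => if s ≤ τ then F s else g, ?_, ?_, ?_⟩
  · simpa [hτ.le] using h0
  · intro t ht ht0
    by_cases htτ : t ≤ τ
    · simpa [htτ] using hbranch t htτ ht0
    · simpa [htτ] using hgb (γ t) (hγ t ⟨(not_le.1 htτ).le, ht⟩)
  · intro t ht
    rcases lt_trichotomy t τ with hlt | rfl | hgt
    · filter_upwards [hcoh t hlt.le, Iio_mem_nhds hlt] with s hs hsτ _
      have hsτ : s < τ := hsτ
      simpa [hsτ.le, hlt.le] using hs hsτ.le
    -- At the junction, `g` agrees with the old germ near γ(τ), hence also near γ(s) for s close to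
    -- τ.
    · have hg' := (γ.continuous.tendsto t).eventually (eventually_eventually_nhds.2 hg)
      filter_upwards [hcoh t le_rfl, hg'] with s hs hgs _
      by_cases hst : s ≤ t
      · simpa [hst] using hs hst
      · simp only [hst, if_false, le_refl, if_true]; exact hgs
    · filter_upwards [Ioi_mem_nhds hgt] with s hs _
      have hs : τ < s := hs
      simp [not_le.2 hs, not_le.2 hgt]

theorem isNomeContinuationUpTo_nome {γ : C(I, ℂ)} (hγ : IsCurveFromOrigin γ) {τ : I}
    (h : ∀ s ≤ τ, γ s ∈ oneCutPlane) : IsNomeContinuationUpTo γ τ fun _ => nome :=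
  ⟨EventuallyEq.rfl, fun t ht h0 => Or.inl (isLogBranch_nome (h t ht) (hγ.2 t h0).1),
    fun _ _ => Eventually.of_forall fun _ _ => EventuallyEq.rfl⟩

/-- A fine subdivision of the time interval puts each piece either in the initial stretch inside the
unit disk, where the nome itself serves, or in a ball to which all branches extend. Every germ
obtained is a branch, which gives the bound by 1. -/
theorem exists_nome_continuation {γ : C(I, ℂ)} (hγ : IsCurveFromOrigin γ) :
    ∃ Q : I → ℂ → ℂ, IsContinuationAlong γ nome Q ∧ ∀ t, ‖Q t (γ t)‖ < 1 := by
  have hpre : γ ⁻¹' Metric.ball 0 1 ∈ 𝓝 (⊥ : I) := by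
    refine γ.continuous.continuousAt.preimage_mem_nhds (Metric.isOpen_ball.mem_nhds ?_)
    change γ 0 ∈ _
    rw [hγ.1]; simp
  obtain ⟨t₀, ht₀, hsub⟩ := nhds_bot_basis.mem_iff.1 hpre
  have hcut : ∀ s < t₀, γ s ∈ oneCutPlane := fun s hs =>
    mem_oneCutPlane_of_norm_lt_one (mem_ball_zero_iff.1 (hsub hs))
  choose! r hr hext using fun (u : I) (hu : u ≠ 0) =>
    exists_ball_extension (hγ.2 u hu).1 (hγ.2 u hu).2
  -- The origin has no extension ball, so it gets the separate set `none`; the factor `Set.Ioi 0`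
  -- ensures that an extension starts at a positive time.
  set c : Option {u : I // u ≠ 0} → Set I := fun i => match i with
    | none => Set.Iio t₀
    | some u => Set.Ioi 0 ∩ γ ⁻¹' Metric.ball (γ u) (r u) with hc
  obtain ⟨t, ht0, hmono, ⟨N, hN⟩, hcov⟩ := exists_monotone_Icc_subset_open_cover_unitInterval
    (c := c)
    (by
      rintro (_ | u)
      · exact isOpen_Iio
      · exact isOpen_Ioi.inter (Metric.isOpen_ball.preimage γ.continuous))
    (by
      intro s _
      rcases eq_or_ne s 0 with rfl | hs
      · exact Set.mem_iUnion.2 ⟨none, ht₀⟩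
      · exact Set.mem_iUnion.2 ⟨some ⟨s, hs⟩, unitInterval.pos_iff_ne_zero.2 hs,
          Metric.mem_ball_self (hr s hs)⟩)
  have key : ∀ n, ∃ F, IsNomeContinuationUpTo γ (t n) F := by
    intro n
    induction n with
    | zero =>
      refine ⟨_, isNomeContinuationUpTo_nome hγ fun s hs => hcut s (hs.trans_lt ?_)⟩
      rw [ht0]; exact ht₀
    | succ n ih =>
      have hle : t n ≤ t (n + 1) := hmono (Nat.le_succ n)
      obtain ⟨i, hi⟩ := hcov n
      rcases i with _ | u
      · have hlt : t (n + 1) < t₀ := hi ⟨hle, le_rfl⟩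
        exact ⟨_, isNomeContinuationUpTo_nome hγ fun s hs => hcut s (hs.trans_lt hlt)⟩
      · obtain ⟨F, hF⟩ := ih
        exact hF.extend (hi ⟨le_rfl, hle⟩).1 hle (hext u u.2) fun s hs => (hi hs).2
  obtain ⟨Q, h0, hbranch, hcoh⟩ := key N
  rw [hN N le_rfl] at hbranch hcoh
  refine ⟨Q, ⟨by rw [hγ.1]; exact h0, fun s => ?_, fun s => ?_⟩, fun s => ?_⟩
  · rcases eq_or_ne s 0 with rfl | hs
    · rw [hγ.1]
      exact (nome_analyticAt zero_mem_oneCutPlane).congr h0.symm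
    · exact (hbranch s le_top hs).analyticAt
  · filter_upwards [hcoh s le_top] with u hu using hu le_top
  · rcases eq_or_ne s 0 with rfl | hs
    · rw [hγ.1, h0.self_of_nhds, nome_zero]; simp
    · exact (hbranch s le_top hs).norm_lt_one

theorem IsContinuationAlong.continuous_apply {γ : C(I, ℂ)} {f : ℂ → ℂ} {F : I → ℂ → ℂ}
    (h : IsContinuationAlong γ f F) : Continuous fun t => F t (γ t) := by
  refine continuous_iff_continuousAt.2 fun t => ?_
  have h1 : ContinuousAt (fun s => F t (γ s)) t :=
    ContinuousAt.comp (g := F t) (h.analyticAt t).continuousAt γ.continuous.continuousAt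
  refine h1.congr ?_
  filter_upwards [h.coherent t] with s hs using hs.self_of_nhds.symm

/-- Post-composition of a continuation with an analytic function. -/
theorem IsContinuationAlong.comp_left {γ : C(I, ℂ)} {f g h : ℂ → ℂ} {F : I → ℂ → ℂ}
    (hF : IsContinuationAlong γ f F) (hg : ∀ t, AnalyticAt ℂ g (F t (γ t)))
    (hh : ∀ᶠ z in 𝓝 (γ 0), h z = g (f z)) :
    IsContinuationAlong γ h fun t z => g (F t z) where
  start := by
    filter_upwards [hF.start, hh] with z h1 h2
    rw [h1, h2]
  analyticAt t := (hg t).comp (hF.analyticAt t)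
  coherent t := by
    filter_upwards [hF.coherent t] with s hs
    filter_upwards [hs] with z hz
    rw [hz]

theorem norm_pow_two_pow_le {q : ℂ} (hq : ‖q‖ ≤ 1) (n : ℕ) : ‖q ^ 2 ^ n‖ ≤ ‖q‖ := by
  rw [norm_pow]
  exact pow_le_of_le_one (norm_nonneg _) hq (by positivity)

/-- Powers q^{2^n} stay in the compact disk, where e is bounded by some C, so the exponent is at
most C 2^{-n}. -/
theorem tendstoUniformlyOn_mul_exp {e : ℂ → ℂ} {ρ : ℝ} (hρ : ρ ≤ 1)
    (he : ContinuousOn e (Metric.closedBall 0 ρ)) :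
    TendstoUniformlyOn (fun n q => q * Complex.exp (e (q ^ 2 ^ n) / 2 ^ n)) id atTop
      (Metric.closedBall 0 ρ) := by
  obtain ⟨C, hC⟩ := (isCompact_closedBall (0 : ℂ) ρ).exists_bound_of_continuousOn he
  have hlim : Tendsto (fun n : ℕ => C * (1 / 2 : ℝ) ^ n) atTop (𝓝 0) := by
    simpa using (tendsto_pow_atTop_nhds_zero_of_lt_one (by norm_num : (0 : ℝ) ≤ 1 / 2)
      (by norm_num)).const_mul C
  rw [Metric.tendstoUniformlyOn_iff]
  intro ε hε
  filter_upwards [hlim.eventually_lt_const (half_pos hε),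
    hlim.eventually_lt_const one_pos] with n h1 h2 q hq
  have hqρ : ‖q‖ ≤ ρ := mem_closedBall_zero_iff.1 hq
  have hqn : ‖q ^ 2 ^ n‖ ≤ ρ := (norm_pow_two_pow_le (hqρ.trans hρ) n).trans hqρ
  have hx : ‖e (q ^ 2 ^ n) / 2 ^ n‖ ≤ C * (1 / 2 : ℝ) ^ n := by
    rw [norm_div, norm_pow, one_div, inv_pow, ← div_eq_mul_inv]
    have : ‖(2 : ℂ)‖ = 2 := by norm_num
    rw [this]
    gcongr
    exact hC _ (mem_closedBall_zero_iff.2 hqn)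
  rw [dist_comm, dist_eq_norm, id,
    show q * Complex.exp (e (q ^ 2 ^ n) / 2 ^ n) - q =
      q * (Complex.exp (e (q ^ 2 ^ n) / 2 ^ n) - 1) by ring, norm_mul]
  have h3 := Complex.norm_exp_sub_one_le (hx.trans h2.le)
  calc ‖q‖ * ‖Complex.exp (e (q ^ 2 ^ n) / 2 ^ n) - 1‖
      ≤ 1 * (2 * ‖e (q ^ 2 ^ n) / 2 ^ n‖) :=
        mul_le_mul (hqρ.trans hρ) h3 (norm_nonneg _) zero_le_one
    _ < ε := by linarith

theorem exists_continuations_along {γ : C(I, ℂ)} (hγ : IsCurveFromOrigin γ) :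
    ∃ (F : ℕ → I → ℂ → ℂ) (Q : I → ℂ → ℂ),
      (∀ n, IsContinuationAlong γ (psiComp n) (F n)) ∧ IsContinuationAlong γ nome Q ∧
      ∀ t, ∃ r : ℝ, 0 < r ∧
        (∀ n, DifferentiableOn ℂ (F n t) (Metric.ball (γ t) r)) ∧
        DifferentiableOn ℂ (Q t) (Metric.ball (γ t) r) ∧
        TendstoUniformlyOn (fun n => F n t) (Q t) atTop (Metric.ball (γ t) r) := by
  obtain ⟨Q, hQ, hQ1⟩ := exists_nome_continuation hγ
  -- The modulus of the continued nome attains its maximum, so a single ρ < 1, and with it a single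
  -- e, serves the whole curve and all n.
  obtain ⟨tm, -, htm⟩ := isCompact_univ.exists_isMaxOn Set.univ_nonempty
    hQ.continuous_apply.norm.continuousOn
  obtain ⟨ρ, hρm, hρ1⟩ := exists_between (hQ1 tm)
  have hρ0 : 0 < ρ := (norm_nonneg _).trans_lt hρm
  have hQρ : ∀ t, ‖Q t (γ t)‖ < ρ := fun t => (htm (Set.mem_univ t)).trans_lt hρm
  obtain ⟨e, hed, he⟩ := exists_log_on_disk hρ0 hρ1
  set g : ℕ → ℂ → ℂ := fun n q => q * Complex.exp (e (q ^ 2 ^ n) / 2 ^ n) with hg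
  have hgd : ∀ n, DifferentiableOn ℂ (g n) (Metric.ball 0 ρ) := by
    intro n
    have h1 : Set.MapsTo (fun q : ℂ => q ^ 2 ^ n) (Metric.ball 0 ρ) (Metric.ball 0 ρ) := by
      intro q hq
      rw [mem_ball_zero_iff] at hq ⊢
      exact (norm_pow_two_pow_le (hq.trans hρ1).le n).trans_lt hq
    have h2 := hed.comp (f := fun q : ℂ => q ^ 2 ^ n) (by fun_prop) h1
    exact differentiableOn_id.mul (h2.div_const _).cexp
  refine ⟨fun n t z => g n (Q t z), Q, fun n => hQ.comp_left (fun t => ?_) ?_, hQ, fun t => ?_⟩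
  · exact (hgd n).analyticAt (Metric.isOpen_ball.mem_nhds (mem_ball_zero_iff.2 (hQρ t)))
  · rw [hγ.1]
    exact he n
  -- The smaller radius leaves a closed disk inside the domain of e, as uniform convergence
  -- requires.
  · obtain ⟨ρ', hρ't, hρ'⟩ := exists_between (hQρ t)
    obtain ⟨r, hr, hball⟩ := Metric.mem_nhds_iff.1
      ((hQ.analyticAt t).eventually_analyticAt.and
        ((hQ.analyticAt t).continuousAt.norm.eventually_lt_const hρ't))
    have hQd : DifferentiableOn ℂ (Q t) (Metric.ball (γ t) r) := fun z hz =>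
      (hball hz).1.differentiableAt.differentiableWithinAt
    refine ⟨r, hr, fun n => (hgd n).comp hQd fun z hz => ?_, hQd, ?_⟩
    · exact mem_ball_zero_iff.2 ((hball hz).2.trans hρ')
    · have h := tendstoUniformlyOn_mul_exp (hρ'.trans hρ1).le
        (hed.continuousOn.mono (Metric.closedBall_subset_ball hρ'))
      exact (h.comp (Q t)).mono fun z hz => mem_closedBall_zero_iff.2 (hball hz).2.le

end

end NomeComposition

theorem theorem2 :
    -- first sheet, principal branches
    TendstoLocallyUniformlyOn NomeComposition.psiComp NomeComposition.nome Filter.atTop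
      NomeComposition.oneCutPlane ∧
    -- all sheets of the covering with fixed origin, by continuation along curves
    ∀ γ : C(unitInterval, ℂ), NomeComposition.IsCurveFromOrigin γ →
      ∃ (F : ℕ → unitInterval → ℂ → ℂ) (Q : unitInterval → ℂ → ℂ),
        (∀ n, NomeComposition.IsContinuationAlong γ (NomeComposition.psiComp n) (F n)) ∧
        NomeComposition.IsContinuationAlong γ NomeComposition.nome Q ∧
        ∀ t, ∃ r : ℝ, 0 < r ∧
          (∀ n, DifferentiableOn ℂ (F n t) (Metric.ball (γ t) r)) ∧
          DifferentiableOn ℂ (Q t) (Metric.ball (γ t) r) ∧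
          TendstoUniformlyOn (fun n => F n t) (Q t) Filter.atTop (Metric.ball (γ t) r) := by
  exact ⟨NomeComposition.tendstoUniformlyOn_psiComp_nome.tendstoLocallyUniformlyOn,
    fun _ hγ => NomeComposition.exists_continuations_along hγ⟩
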